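/- There is an algorithm (a program for the real RAM) and a polynomial $p$ such that for every $n \ge 0$ and every collection $\mathcal{S}$ of $n$ closed axis-aligned squares of positive side length in the plane $\mathbb{R}^2$ (with arbitrary real coordinates, given by their lower left corners and side lengths), the algorithm computes in at most $p(n)$ steps a set $\mathcal{R}$ of at most $9n$ closed, nondegenerate, axis-aligned rectangles with pairwise disjoint interiors such that $\bigcup_{R \in \mathcal{R}} R = \bigcup_{S \in \mathcal{S}} S$ and such that every rectangle $R \in \mathcal{R}$ is contained in some square $S \in \mathcal{S}$. Here the real RAM has memory cells for natural numbers (with addition, truncated subtraction and comparison, used for counting and addressing) and for real numbers (with $+,-,\cdot,/$ and comparison), and every constant, memory access, operation and comparison counts as one step. -/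

import Mathlib

/-- An axis-aligned square of positive side length, given by its lower left corner `(x, y)` and
its side length. -/
structure AASquare where
  x : ℝ
  y : ℝ
  side : ℝ
  side_pos : 0 < side

/-- The (closed) set of points of a square. -/
def AASquare.toSet (q : AASquare) : Set (ℝ × ℝ) :=
  Set.Icc q.x (q.x + q.side) ×ˢ Set.Icc q.y (q.y + q.side)

/-- A nondegenerate axis-aligned rectangle `[x₁, x₂] × [y₁, y₂]`. -/
structure AARect where
  x₁ : ℝ
  x₂ : ℝ
  y₁ : ℝ
  y₂ : ℝ
  hx : x₁ < x₂
  hy : y₁ < y₂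

/-- The (closed) set of points of a rectangle. -/
def AARect.toSet (r : AARect) : Set (ℝ × ℝ) :=
  Set.Icc r.x₁ r.x₂ ×ˢ Set.Icc r.y₁ r.y₂

/-! The real RAM. The memory consists of arrays of natural numbers (used for counting and for
addressing) and of arrays of real numbers; a scalar variable is a cell with a constant index.
A program is a finite piece of structured code. Evaluating an expression or a condition costs one
step for each of its constants, memory accesses, operations and comparisons. The operations on
natural numbers are addition and truncated subtraction, those on real numbers are the four
arithmetic operations; real numbers can be compared, but not rounded or used as addresses. -/

namespace RealRAM

/-- The contents of the memory: `nat a i` and `real a i` are the `i`-th cells of the `a`-th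
array of natural numbers and of the `a`-th array of real numbers. -/
structure State where
  nat : ℕ → ℕ → ℕ
  real : ℕ → ℕ → ℝ

/-- Write `v` into cell `i` of the natural number array `a`. -/
def State.setNat (s : State) (a i v : ℕ) : State :=
  { s with nat := Function.update s.nat a (Function.update (s.nat a) i v) }

/-- Write `v` into cell `i` of the real array `a`. -/
noncomputable def State.setReal (s : State) (a i : ℕ) (v : ℝ) : State :=
  { s with real := Function.update s.real a (Function.update (s.real a) i v) }

/-- Expressions with natural number values; `get a i` reads cell `i` of array `a`. -/
inductive NatExpr where
  | const (c : ℕ)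
  | get (a : ℕ) (i : NatExpr)
  | add (e f : NatExpr)
  | sub (e f : NatExpr)

def NatExpr.eval (s : State) : NatExpr → ℕ
  | .const c => c
  | .get a i => s.nat a (i.eval s)
  | .add e f => e.eval s + f.eval s
  | .sub e f => e.eval s - f.eval s

def NatExpr.cost : NatExpr → ℕ
  | .const _ => 1
  | .get _ i => i.cost + 1
  | .add e f => e.cost + f.cost + 1
  | .sub e f => e.cost + f.cost + 1

/-- Expressions with real values; `get a i` reads cell `i` of array `a`. The only constants are
rational numbers. -/
inductive RealExpr where
  | const (c : ℚ)
  | get (a : ℕ) (i : NatExpr)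
  | add (e f : RealExpr)
  | sub (e f : RealExpr)
  | mul (e f : RealExpr)
  | div (e f : RealExpr)

noncomputable def RealExpr.eval (s : State) : RealExpr → ℝ
  | .const c => (c : ℝ)
  | .get a i => s.real a (i.eval s)
  | .add e f => e.eval s + f.eval s
  | .sub e f => e.eval s - f.eval s
  | .mul e f => e.eval s * f.eval s
  | .div e f => e.eval s / f.eval s

def RealExpr.cost : RealExpr → ℕ
  | .const _ => 1
  | .get _ i => i.cost + 1
  | .add e f => e.cost + f.cost + 1
  | .sub e f => e.cost + f.cost + 1
  | .mul e f => e.cost + f.cost + 1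
  | .div e f => e.cost + f.cost + 1

/-- Conditions: Boolean combinations of comparisons. -/
inductive Cond where
  | natLe (e f : NatExpr)
  | realLe (e f : RealExpr)
  | not (b : Cond)
  | and (b c : Cond)

def Cond.Holds (s : State) : Cond → Prop
  | .natLe e f => e.eval s ≤ f.eval s
  | .realLe e f => e.eval s ≤ f.eval s
  | .not b => ¬ b.Holds s
  | .and b c => b.Holds s ∧ c.Holds s

def Cond.cost : Cond → ℕ
  | .natLe e f => e.cost + f.cost + 1
  | .realLe e f => e.cost + f.cost + 1
  | .not b => b.cost + 1
  | .and b c => b.cost + c.cost + 1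

/-- Programs: assignments to a memory cell, sequencing, branching, and while-loops. -/
inductive Prog where
  | skip
  | setNat (a : ℕ) (i e : NatExpr)
  | setReal (a : ℕ) (i : NatExpr) (e : RealExpr)
  | seq (p q : Prog)
  | ite (b : Cond) (p q : Prog)
  | loop (b : Cond) (p : Prog)

/-- `Run p s t s'`: the program `p`, started with memory contents `s`, halts after exactly `t`
steps with memory contents `s'`. -/
inductive Run : Prog → State → ℕ → State → Prop where
  | skip (s : State) : Run .skip s 1 s
  | setNat (a : ℕ) (i e : NatExpr) (s : State) :
      Run (.setNat a i e) s (i.cost + e.cost + 1) (s.setNat a (i.eval s) (e.eval s))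
  | setReal (a : ℕ) (i : NatExpr) (e : RealExpr) (s : State) :
      Run (.setReal a i e) s (i.cost + e.cost + 1) (s.setReal a (i.eval s) (e.eval s))
  | seq {p q : Prog} {s s' s'' : State} {t t' : ℕ} :
      Run p s t s' → Run q s' t' s'' → Run (.seq p q) s (t + t') s''
  | ite_true {b : Cond} {p q : Prog} {s s' : State} {t : ℕ} :
      b.Holds s → Run p s t s' → Run (.ite b p q) s (b.cost + 1 + t) s'
  | ite_false {b : Cond} {p q : Prog} {s s' : State} {t : ℕ} :
      ¬ b.Holds s → Run q s t s' → Run (.ite b p q) s (b.cost + 1 + t) s'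
  | loop_true {b : Cond} {p : Prog} {s s' s'' : State} {t t' : ℕ} :
      b.Holds s → Run p s t s' → Run (.loop b p) s' t' s'' →
        Run (.loop b p) s (b.cost + 1 + t + t') s''
  | loop_false {b : Cond} {p : Prog} {s : State} :
      ¬ b.Holds s → Run (.loop b p) s (b.cost + 1) s

/-- The initial memory for the input `S 0, …, S (n - 1)`: the number `n` is in cell `0` of the
natural number array `0`, the lower left corner and the side length of the `i`-th square are in
cells `i` of the real arrays `0`, `1` and `2`, and all other cells are zero. -/
noncomputable def input {n : ℕ} (S : Fin n → AASquare) : State where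
  nat a i := if a = 0 ∧ i = 0 then n else 0
  real a i :=
    if h : i < n then
      if a = 0 then (S ⟨i, h⟩).x
      else if a = 1 then (S ⟨i, h⟩).y
      else if a = 2 then (S ⟨i, h⟩).side
      else 0
    else 0

/-- The memory `s` holds the list `R` as output: its length is in cell `0` of the natural number
array `0`, and the bounds of its `j`-th rectangle are in cells `j` of the real arrays
`0`, `1`, `2` and `3`. -/
def HasOutput (s : State) (R : List AARect) : Prop :=
  s.nat 0 0 = R.length ∧
    ∀ (j : ℕ) (hj : j < R.length),
      s.real 0 j = R[j].x₁ ∧ s.real 1 j = R[j].x₂ ∧ s.real 2 j = R[j].y₁ ∧ s.real 3 j = R[j].y₂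

end RealRAM

/-!
Give a square priority over another if it is larger, or equally large and earlier in the input.
A square `S` is responsible for the points that it contains and no square with priority contains.
A square with priority that meets a vertical line on which `S` has a segment covers the lower or
the upper end of that segment, or misses the segment altogether, because it is at least as tall as
`S`. So what is left of the segment is a single interval, from `low` to `high`; on the interval
between two consecutive abscissas of vertical sides it does not change. The algorithm sweeps over
each square `S` from left to right, and outputs a rectangle for each maximal range on which
`low` and `high` are constant and `low < high`. All intervals are taken half-open, so that
`low` and `high` at `c` describe the situation immediately to the right of `c`. The rectangles are
contained in their squares by construction, their interiors are disjoint, and they cover the union,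
because a point belongs to the rectangle of the square with the highest priority among those
containing it (`SquareSeq.IsPartial.half_open_subset`).

There are at most `6 n` rectangles, because each can be charged to a square in one of six ways
(`SquareSeq.Charged`) such that no two rectangles are charged to the same square in the same way.
A rectangle of `S` that starts neither at the left side of `S` nor at a lower corner of a
square has its lower left vertex at a point where the bottom side of `S`, or the top or right side
of a square with priority over `S`, emerges from the squares with priority over it, in the positive
direction, or where such a top side starts (`SquareSeq.IsPiece.exists_charged`). Each side emerges
at most once, since the squares with priority are at least as large: a square that ends at a point
of the side covers the whole part of the side before that point (`SquareSeq.leave_right_le`,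
`SquareSeq.leave_top_le`).

The program is a direct transcription of this sweep into nested loops. Its correctness and its
running time are proved together, by a Hoare calculus (`RealRAM.Runs`) in which a program comes with
a bound for the number of its steps.
-/

/-! ### Squares in a column -/

/-- A finite family of axis-aligned squares, stored as sequences of which only the first `len`
terms matter: the `i`-th square has the lower left corner `(x i, y i)` and the side `w i`. -/
structure SquareSeq where
  len : ℕ
  x : ℕ → ℝ
  y : ℕ → ℝ
  w : ℕ → ℝ
  w_pos : ∀ i < len, 0 < w i

namespace SquareSeq

variable (Q : SquareSeq)

/-- The abscissa of the right side of the `i`-th square. -/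
noncomputable def right (i : ℕ) : ℝ := Q.x i + Q.w i

/-- The ordinate of the top side of the `i`-th square. -/
noncomputable def top (i : ℕ) : ℝ := Q.y i + Q.w i

/-- The `j`-th square has priority over the `i`-th one: it is larger, or equally large and
earlier in the sequence. -/
def Prec (j i : ℕ) : Prop := Q.w i ≤ Q.w j ∧ ¬ (Q.w j ≤ Q.w i ∧ i ≤ j)

/-- The `j`-th square has priority over the `i`-th one and meets the vertical line at `z`, or
rather the lines immediately to the right of it. -/
def Blocks (i : ℕ) (z : ℝ) (j : ℕ) : Prop := Q.Prec j i ∧ Q.x j ≤ z ∧ z < Q.right j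

open scoped Classical in
/-- The lower end of what the first `m` squares leave of the `i`-th square on the vertical line
at `z`. A square with priority that does not start above the bottom of the `i`-th square takes
away a lower part of the segment. -/
noncomputable def lowAux (i : ℕ) (z : ℝ) : ℕ → ℝ
  | 0 => Q.y i
  | m + 1 =>
    if Q.Blocks i z m ∧ Q.y m ≤ Q.y i then max (lowAux i z m) (Q.top m) else lowAux i z m

open scoped Classical in
/-- The upper end of what the first `m` squares leave of the `i`-th square on the vertical line
at `z`. A square with priority that starts above the bottom of the `i`-th square also ends above
its top, and so takes away an upper part of the segment. -/
noncomputable def highAux (i : ℕ) (z : ℝ) : ℕ → ℝ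
  | 0 => Q.top i
  | m + 1 =>
    if Q.Blocks i z m ∧ ¬ Q.y m ≤ Q.y i then min (highAux i z m) (Q.y m) else highAux i z m

/-- The lower end of the part of the `i`-th square on the line at `z` that the squares with
priority leave free. -/
noncomputable def low (i : ℕ) (z : ℝ) : ℝ := Q.lowAux i z Q.len

/-- The upper end of the part of the `i`-th square on the line at `z` that the squares with
priority leave free; this part is empty if `high ≤ low`. -/
noncomputable def high (i : ℕ) (z : ℝ) : ℝ := Q.highAux i z Q.len

variable {Q} {i j k m : ℕ} {z z' v : ℝ}

theorem Prec.trans (h : Q.Prec i j) (h' : Q.Prec j k) : Q.Prec i k := by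
  obtain ⟨h1, h2⟩ := h
  obtain ⟨h3, h4⟩ := h'
  refine ⟨h3.trans h1, fun ⟨h5, h6⟩ => ?_⟩
  by_cases h : j ≤ i
  · exact h2 ⟨h5.trans h3, h⟩
  · exact h4 ⟨h1.trans h5, by omega⟩

theorem prec_irrefl : ¬ Q.Prec i i := fun h => h.2 ⟨le_rfl, le_rfl⟩

theorem prec_trichotomy (h : i ≠ j) : Q.Prec i j ∨ Q.Prec j i := by
  unfold Prec
  rcases lt_trichotomy (Q.w i) (Q.w j) with h1 | h1 | h1
  · exact Or.inr ⟨h1.le, fun h => absurd h.1 (not_le.2 h1)⟩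
  · rcases lt_or_gt_of_ne h with h2 | h2
    · exact Or.inl ⟨h1.ge, fun h => absurd h.2 (not_le.2 h2)⟩
    · exact Or.inr ⟨h1.le, fun h => absurd h.2 (not_le.2 h2)⟩
  · exact Or.inl ⟨h1.le, fun h => absurd h.1 (not_le.2 h1)⟩

theorem lowAux_le_iff : Q.lowAux i z m ≤ v ↔
    Q.y i ≤ v ∧ ∀ j < m, Q.Blocks i z j → Q.y j ≤ Q.y i → Q.top j ≤ v := by
  induction m with
  | zero => simp [lowAux]
  | succ m ih =>
    simp only [lowAux, Nat.forall_lt_succ_right]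
    split_ifs with h
    · rw [max_le_iff, ih]; tauto
    · rw [ih]; tauto

theorem le_highAux_iff : v ≤ Q.highAux i z m ↔
    v ≤ Q.top i ∧ ∀ j < m, Q.Blocks i z j → ¬ Q.y j ≤ Q.y i → v ≤ Q.y j := by
  induction m with
  | zero => simp [highAux]
  | succ m ih =>
    simp only [highAux, Nat.forall_lt_succ_right]
    split_ifs with h
    · rw [le_min_iff, ih]; tauto
    · rw [ih]; tauto

theorem low_le_iff : Q.low i z ≤ v ↔
    Q.y i ≤ v ∧ ∀ j < Q.len, Q.Blocks i z j → Q.y j ≤ Q.y i → Q.top j ≤ v := lowAux_le_iff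

theorem le_high_iff : v ≤ Q.high i z ↔
    v ≤ Q.top i ∧ ∀ j < Q.len, Q.Blocks i z j → ¬ Q.y j ≤ Q.y i → v ≤ Q.y j := le_highAux_iff

theorem y_le_low : Q.y i ≤ Q.low i z := (low_le_iff.1 le_rfl).1

theorem high_le_top : Q.high i z ≤ Q.top i := (le_high_iff.1 le_rfl).1

theorem Blocks.top_le_low (h : Q.Blocks i z j) (hj : j < Q.len) (hy : Q.y j ≤ Q.y i) :
    Q.top j ≤ Q.low i z := (low_le_iff.1 le_rfl).2 j hj h hy

theorem Blocks.high_le_y (h : Q.Blocks i z j) (hj : j < Q.len) (hy : ¬ Q.y j ≤ Q.y i) :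
    Q.high i z ≤ Q.y j := (le_high_iff.1 le_rfl).2 j hj h hy

theorem low_eq (i : ℕ) (z : ℝ) : Q.low i z = Q.y i ∨
    ∃ j < Q.len, Q.Blocks i z j ∧ Q.y j ≤ Q.y i ∧ Q.low i z = Q.top j := by
  unfold low
  generalize Q.len = m
  induction m with
  | zero => simp [lowAux]
  | succ m ih =>
    simp only [lowAux]
    split_ifs with h
    · rcases max_choice (Q.lowAux i z m) (Q.top m) with h' | h' <;> rw [h']
      · rcases ih with ih | ⟨j, hj, h1⟩
        · exact Or.inl ih
        · exact Or.inr ⟨j, by omega, h1⟩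
      · exact Or.inr ⟨m, by omega, h.1, h.2, rfl⟩
    · rcases ih with ih | ⟨j, hj, h1⟩
      · exact Or.inl ih
      · exact Or.inr ⟨j, by omega, h1⟩

theorem high_eq (i : ℕ) (z : ℝ) : Q.high i z = Q.top i ∨
    ∃ j < Q.len, Q.Blocks i z j ∧ ¬ Q.y j ≤ Q.y i ∧ Q.high i z = Q.y j := by
  unfold high
  generalize Q.len = m
  induction m with
  | zero => simp [highAux]
  | succ m ih =>
    simp only [highAux]
    split_ifs with h
    · rcases min_choice (Q.highAux i z m) (Q.y m) with h' | h' <;> rw [h']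
      · rcases ih with ih | ⟨j, hj, h1⟩
        · exact Or.inl ih
        · exact Or.inr ⟨j, by omega, h1⟩
      · exact Or.inr ⟨m, by omega, h.1, h.2, rfl⟩
    · rcases ih with ih | ⟨j, hj, h1⟩
      · exact Or.inl ih
      · exact Or.inr ⟨j, by omega, h1⟩

/-- The free part of a column is disjoint from the squares with priority. -/
theorem Blocks.not_mem_free (h : Q.Blocks i z j) (hj : j < Q.len) (h1 : Q.low i z ≤ v)
    (h2 : v < Q.high i z) : ¬ (Q.y j ≤ v ∧ v < Q.top j) := by
  rintro ⟨h3, h4⟩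
  by_cases hy : Q.y j ≤ Q.y i
  · linarith [h.top_le_low hj hy]
  · linarith [h.high_le_y hj hy]

/-! ### Breakpoints -/

/-- The abscissas of the vertical sides. -/
noncomputable def coords (Q : SquareSeq) : Finset ℝ :=
  (Finset.range Q.len).image Q.x ∪ (Finset.range Q.len).image Q.right

theorem mem_coords {e : ℝ} : e ∈ Q.coords ↔ ∃ j < Q.len, e = Q.x j ∨ e = Q.right j := by
  simp only [coords, Finset.mem_union, Finset.mem_image, Finset.mem_range]
  constructor
  · rintro (⟨j, h, rfl⟩ | ⟨j, h, rfl⟩)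
    · exact ⟨j, h, Or.inl rfl⟩
    · exact ⟨j, h, Or.inr rfl⟩
  · rintro ⟨j, h, rfl | rfl⟩
    · exact Or.inl ⟨j, h, rfl⟩
    · exact Or.inr ⟨j, h, rfl⟩

theorem x_mem_coords (h : j < Q.len) : Q.x j ∈ Q.coords := mem_coords.2 ⟨j, h, Or.inl rfl⟩

theorem right_mem_coords (h : j < Q.len) : Q.right j ∈ Q.coords :=
  mem_coords.2 ⟨j, h, Or.inr rfl⟩

theorem card_coords_le : Q.coords.card ≤ 2 * Q.len := by
  refine (Finset.card_union_le _ _).trans ?_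
  have h1 := Finset.card_image_le (s := Finset.range Q.len) (f := Q.x)
  have h2 := Finset.card_image_le (s := Finset.range Q.len) (f := Q.right)
  rw [Finset.card_range] at h1 h2
  omega

theorem x_lt_right (h : j < Q.len) : Q.x j < Q.right j := by
  have := Q.w_pos j h
  unfold right; linarith

theorem y_lt_top (h : j < Q.len) : Q.y j < Q.top j := by
  have := Q.w_pos j h
  unfold top; linarith

theorem blocks_congr (hzz : z ≤ z') (h : ∀ e ∈ Q.coords, z < e → z' < e) (hj : j < Q.len) :
    Q.Blocks i z j ↔ Q.Blocks i z' j := by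
  have h1 := h _ (x_mem_coords hj)
  have h2 := h _ (right_mem_coords hj)
  unfold Blocks
  constructor
  · rintro ⟨h3, h4, h5⟩
    exact ⟨h3, h4.trans hzz, h2 h5⟩
  · rintro ⟨h3, h4, h5⟩
    refine ⟨h3, ?_, hzz.trans_lt h5⟩
    by_contra h6
    linarith [h1 (not_le.1 h6)]

/-- The free part of a column only changes at vertical sides. -/
theorem low_congr (hzz : z ≤ z') (h : ∀ e ∈ Q.coords, z < e → z' < e) :
    Q.low i z = Q.low i z' := by
  apply eq_of_forall_ge_iff
  intro v
  rw [low_le_iff, low_le_iff]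
  refine and_congr_right fun _ => forall₂_congr fun j hj => ?_
  rw [blocks_congr hzz h hj]

theorem high_congr (hzz : z ≤ z') (h : ∀ e ∈ Q.coords, z < e → z' < e) :
    Q.high i z = Q.high i z' := by
  apply eq_of_forall_le_iff
  intro v
  rw [le_high_iff, le_high_iff]
  refine and_congr_right fun _ => forall₂_congr fun j hj => ?_
  rw [blocks_congr hzz h hj]

/-- `c` is the left side of the `i`-th square, or the free parts of its columns change at `c`. The
situation immediately to the left of `c` is read off at a point `z < c` such that no vertical side
lies strictly between `z` and `c`. -/
def IsBreak (Q : SquareSeq) (i : ℕ) (c : ℝ) : Prop :=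
  c = Q.x i ∨ ∃ z, Q.x i ≤ z ∧ z < c ∧ (∀ e ∈ Q.coords, z < e → c ≤ e) ∧
    ¬ (Q.low i c = Q.low i z ∧ Q.high i c = Q.high i z)

/-- Among the abscissas in `A`, `d` is the first one after `c` at which the free part of the columns
of the `i`-th square differs from that at `c`, if there is one before the right side of the
square; otherwise `d` is the abscissa of the right side. For `A = Q.coords`, this is the next
breakpoint after `c`. -/
structure IsNext (Q : SquareSeq) (A : Finset ℝ) (i : ℕ) (c d : ℝ) : Prop where
  lt : c < d
  le : d ≤ Q.right i
  mem : d ∈ Q.coords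
  const : ∀ e ∈ A, c < e → e < d → Q.low i e = Q.low i c ∧ Q.high i e = Q.high i c
  change : d = Q.right i ∨ ¬ (Q.low i d = Q.low i c ∧ Q.high i d = Q.high i c)

theorem isNext_right {c : ℝ} (hi : i < Q.len) (hc : c < Q.right i) :
    Q.IsNext ∅ i c (Q.right i) where
  lt := hc
  le := le_rfl
  mem := right_mem_coords hi
  const := by simp
  change := Or.inl rfl

theorem IsNext.mono {A A' : Finset ℝ} {c d : ℝ} (h : Q.IsNext A i c d) (hA : A' ⊆ A) :
    Q.IsNext A' i c d :=
  { h with const := fun e he => h.const e (hA he) }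

theorem IsNext.insert_of_change {A : Finset ℝ} {c d e : ℝ} (h : Q.IsNext A i c d)
    (he : e ∈ Q.coords) (h1 : c < e) (h2 : e < d)
    (h3 : ¬ (Q.low i e = Q.low i c ∧ Q.high i e = Q.high i c)) :
    Q.IsNext (insert e A) i c e where
  lt := h1
  le := h2.le.trans h.le
  mem := he
  const e' he' h4 h5 := by
    rcases Finset.mem_insert.1 he' with rfl | he'
    · exact absurd h5 (lt_irrefl _)
    · exact h.const e' he' h4 (h5.trans h2)
  change := Or.inr h3

theorem IsNext.insert_of_not_change {A : Finset ℝ} {c d e : ℝ} (h : Q.IsNext A i c d)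
    (h1 : ¬ ((c < e ∧ e < d) ∧ ¬ (Q.low i e = Q.low i c ∧ Q.high i e = Q.high i c))) :
    Q.IsNext (insert e A) i c d :=
  { h with
    const := fun e' he' h4 h5 => by
      rcases Finset.mem_insert.1 he' with rfl | he'
      · by_contra h6
        exact h1 ⟨⟨h4, h5⟩, h6⟩
      · exact h.const e' he' h4 h5 }

theorem IsNext.const' {c d : ℝ} (h : Q.IsNext Q.coords i c d) (h1 : c ≤ z) (h2 : z < d) :
    Q.low i z = Q.low i c ∧ Q.high i z = Q.high i c := by
  by_cases hne : (Q.coords.filter fun e => c < e ∧ e ≤ z).Nonempty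
  · -- Compare with the last coordinate before `z`.
    obtain ⟨e, he, hmax⟩ := Finset.exists_max_image _ id hne
    simp only [Finset.mem_filter, id, and_imp] at he hmax
    have hg : ∀ e' ∈ Q.coords, e < e' → z < e' := fun e' he' hlt => by
      by_contra hc
      exact absurd (hmax e' he' (he.2.1.trans hlt) (not_lt.1 hc)) (not_le.2 hlt)
    rw [← low_congr he.2.2 hg, ← high_congr he.2.2 hg]
    exact h.const e he.1 he.2.1 (he.2.2.trans_lt h2)
  · have hg : ∀ e' ∈ Q.coords, c < e' → z < e' := fun e' he' hlt => by
      by_contra hc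
      exact hne ⟨e', by simp [he', hlt, not_lt.1 hc]⟩
    exact ⟨(low_congr h1 hg).symm, (high_congr h1 hg).symm⟩

theorem IsNext.isBreak {c d : ℝ} (h : Q.IsNext Q.coords i c d) (hx : Q.x i ≤ c) (hc : c ∈ Q.coords)
    (hd : d < Q.right i) : Q.IsBreak i d := by
  obtain ⟨e, he, hmax⟩ := Finset.exists_max_image (Q.coords.filter (· < d)) id
    ⟨c, by simp [hc, h.lt]⟩
  simp only [Finset.mem_filter, id, and_imp] at he hmax
  have hce := hmax c hc h.lt
  have := h.const' hce he.2
  refine Or.inr ⟨e, hx.trans hce, he.2, fun e' he' hlt => ?_, ?_⟩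
  · by_contra hc
    exact absurd (hmax e' he' (not_le.1 hc)) (not_le.2 hlt)
  · rw [this.1, this.2]
    exact h.change.resolve_left hd.ne

/-! ### Pieces -/

/-- `r` is a maximal rectangle of the vertical decomposition of the free part of the `i`-th
square. -/
structure IsPiece (Q : SquareSeq) (i : ℕ) (r : AARect) : Prop where
  lt_len : i < Q.len
  x_le : Q.x i ≤ r.x₁
  le_right : r.x₂ ≤ Q.right i
  eq : ∀ z, r.x₁ ≤ z → z < r.x₂ → Q.low i z = r.y₁ ∧ Q.high i z = r.y₂
  isBreak : Q.IsBreak i r.x₁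

theorem _root_.AARect.interior_toSet (r : AARect) :
    interior r.toSet = Set.Ioo r.x₁ r.x₂ ×ˢ Set.Ioo r.y₁ r.y₂ := by
  rw [AARect.toSet, interior_prod_eq, interior_Icc, interior_Icc]

theorem IsPiece.low_left {r : AARect} (h : Q.IsPiece i r) : Q.low i r.x₁ = r.y₁ :=
  (h.eq _ le_rfl r.hx).1

theorem IsPiece.high_left {r : AARect} (h : Q.IsPiece i r) : Q.high i r.x₁ = r.y₂ :=
  (h.eq _ le_rfl r.hx).2

theorem IsPiece.disjoint_of_prec {r r' : AARect} (h : Q.IsPiece i r) (h' : Q.IsPiece j r')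
    (hp : Q.Prec j i) : Disjoint (interior r.toSet) (interior r'.toSet) := by
  rw [r.interior_toSet, r'.interior_toSet, Set.disjoint_left]
  rintro ⟨a, b⟩ ⟨⟨h1, h2⟩, h3, h4⟩ ⟨⟨h5, h6⟩, h7, h8⟩
  simp only at h1 h2 h3 h4 h5 h6 h7 h8
  have he := h.eq a h1.le h2
  have he' := h'.eq a h5.le h6
  refine Blocks.not_mem_free (Q := Q) (i := i) (z := a) (j := j) (v := b)
    ⟨hp, h'.x_le.trans h5.le, h6.trans_le h'.le_right⟩ h'.lt_len (by linarith) (by linarith)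
    ⟨?_, ?_⟩
  · have := y_le_low (Q := Q) (i := j) (z := a)
    linarith
  · have := high_le_top (Q := Q) (i := j) (z := a)
    linarith

theorem _root_.AARect.disjoint_interior_of_x₂_le {r r' : AARect} (h : r.x₂ ≤ r'.x₁) :
    Disjoint (interior r.toSet) (interior r'.toSet) := by
  rw [r.interior_toSet, r'.interior_toSet, Set.disjoint_left]
  rintro ⟨a, b⟩ ⟨⟨h1, h2⟩, -⟩ ⟨⟨h5, h6⟩, -⟩
  simp only at h1 h2 h5 h6
  linarith

/-- The list `R` contains the pieces of the squares before the `i`-th one, and those of the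
`i`-th one to the left of `c`. -/
structure IsPartial (Q : SquareSeq) (i : ℕ) (c : ℝ) (R : List AARect) : Prop where
  piece : ∀ r ∈ R, ∃ j, (j < i ∨ j = i ∧ r.x₂ ≤ c) ∧ Q.IsPiece j r
  cover : ∀ j < Q.len, ∀ z, (j < i ∨ j = i ∧ z < c) → Q.x j ≤ z → z < Q.right j →
    Q.low j z < Q.high j z →
    ∃ r ∈ R, r.x₁ ≤ z ∧ z < r.x₂ ∧ r.y₁ = Q.low j z ∧ r.y₂ = Q.high j z
  disjoint : R.Pairwise fun r r' => Disjoint (interior r.toSet) (interior r'.toSet)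

theorem isPartial_nil : Q.IsPartial 0 (Q.x 0) [] where
  piece := by simp
  cover := by
    rintro j - z (h | ⟨rfl, h⟩) h1
    · omega
    · linarith
  disjoint := List.Pairwise.nil

theorem IsPartial.succ {R : List AARect} (h : Q.IsPartial i (Q.right i) R) :
    Q.IsPartial (i + 1) (Q.x (i + 1)) R where
  piece r hr := by
    obtain ⟨j, h1, h2⟩ := h.piece r hr
    exact ⟨j, Or.inl (by omega), h2⟩
  cover := by
    rintro j hj z (h1 | ⟨rfl, h1⟩) h2 h3 h4
    · refine h.cover j hj z ?_ h2 h3 h4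
      rcases Nat.lt_succ_iff_lt_or_eq.1 h1 with h5 | rfl
      · exact Or.inl h5
      · exact Or.inr ⟨rfl, h3⟩
    · linarith
  disjoint := h.disjoint

theorem IsPartial.skip {R : List AARect} {c d : ℝ} (h : Q.IsPartial i c R)
    (hd : Q.IsNext Q.coords i c d) (hlt : ¬ Q.low i c < Q.high i c) : Q.IsPartial i d R where
  piece r hr := by
    obtain ⟨j, h1, h2⟩ := h.piece r hr
    refine ⟨j, h1.imp_right fun h3 => ⟨h3.1, h3.2.trans hd.lt.le⟩, h2⟩
  cover := by
    rintro j hj z h1 h2 h3 h4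
    refine h.cover j hj z (h1.imp_right ?_) h2 h3 h4
    rintro ⟨rfl, h5⟩
    refine ⟨rfl, ?_⟩
    by_contra h6
    have := hd.const' (not_lt.1 h6) h5
    rw [this.1, this.2] at h4
    exact hlt h4
  disjoint := h.disjoint

theorem IsPartial.append {R : List AARect} {c d : ℝ} (h : Q.IsPartial i c R) (hi : i < Q.len)
    (hc : Q.x i ≤ c) (hb : Q.IsBreak i c) (hd : Q.IsNext Q.coords i c d)
    (hlt : Q.low i c < Q.high i c) :
    Q.IsPartial i d (R ++ [⟨c, d, Q.low i c, Q.high i c, hd.lt, hlt⟩]) := by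
  have hp : Q.IsPiece i ⟨c, d, Q.low i c, Q.high i c, hd.lt, hlt⟩ :=
    ⟨hi, hc, hd.le, fun z h1 h2 => hd.const' h1 h2, hb⟩
  refine ⟨?_, ?_, ?_⟩
  · intro r hr
    rcases List.mem_append.1 hr with hr | hr
    · obtain ⟨j, h1, h2⟩ := h.piece r hr
      exact ⟨j, h1.imp_right fun h3 => ⟨h3.1, h3.2.trans hd.lt.le⟩, h2⟩
    · rw [List.mem_singleton] at hr
      subst hr
      exact ⟨i, Or.inr ⟨rfl, le_rfl⟩, hp⟩
  · intro j hj z h1 h2 h3 h4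
    by_cases h5 : j < i ∨ j = i ∧ z < c
    · obtain ⟨r, hr, h6⟩ := h.cover j hj z h5 h2 h3 h4
      exact ⟨r, List.mem_append_left _ hr, h6⟩
    · obtain ⟨rfl, h6⟩ : j = i ∧ z < d := by
        rcases h1 with h1 | h1
        · exact absurd (Or.inl h1) h5
        · exact h1
      have h7 : c ≤ z := by
        by_contra h7
        exact h5 (Or.inr ⟨rfl, not_le.1 h7⟩)
      have := hd.const' h7 h6
      exact ⟨_, List.mem_append_right _ (List.mem_singleton.2 rfl), h7, h6, this.1.symm,
        this.2.symm⟩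
  · rw [List.pairwise_append]
    refine ⟨h.disjoint, List.pairwise_singleton _ _, fun r hr r' hr' => ?_⟩
    rw [List.mem_singleton] at hr'
    subst hr'
    obtain ⟨j, h1 | ⟨rfl, h1⟩, h2⟩ := h.piece r hr
    · rcases prec_trichotomy (Q := Q) (i := i) (j := j) (by omega) with h3 | h3
      · exact h2.disjoint_of_prec hp h3
      · exact (hp.disjoint_of_prec h2 h3).symm
    · exact AARect.disjoint_interior_of_x₂_le h1

/-! ### Counting the pieces -/

/-- Two pieces that contain the quarter disks to the upper right of the same point coincide. -/
theorem IsPartial.eq_of_mem_upper {R : List AARect} {c : ℝ} (h : Q.IsPartial i c R)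
    {r r' : AARect} (hr : r ∈ R) (hr' : r' ∈ R) {a b : ℝ}
    (h1 : r.x₁ ≤ a) (h2 : a < r.x₂) (h3 : r.y₁ ≤ b) (h4 : b < r.y₂)
    (h1' : r'.x₁ ≤ a) (h2' : a < r'.x₂) (h3' : r'.y₁ ≤ b) (h4' : b < r'.y₂) : r = r' := by
  by_contra hne
  have : Std.Symm fun r r' : AARect => Disjoint (interior r.toSet) (interior r'.toSet) :=
    ⟨fun _ _ h => h.symm⟩
  have := h.disjoint.forall hr hr' hne
  rw [r.interior_toSet, r'.interior_toSet, Set.disjoint_left] at this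
  obtain ⟨a', h5, h6⟩ := exists_between (lt_min h2 h2')
  obtain ⟨b', h7, h8⟩ := exists_between (lt_min h4 h4')
  rw [lt_min_iff] at h6 h8
  exact this (a := (a', b')) ⟨⟨h1.trans_lt h5, h6.1⟩, h3.trans_lt h7, h8.1⟩
    ⟨⟨h1'.trans_lt h5, h6.2⟩, h3'.trans_lt h7, h8.2⟩

/-- Two pieces that contain the quarter disks to the lower right of the same point coincide. -/
theorem IsPartial.eq_of_mem_lower {R : List AARect} {c : ℝ} (h : Q.IsPartial i c R)
    {r r' : AARect} (hr : r ∈ R) (hr' : r' ∈ R) {a b : ℝ}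
    (h1 : r.x₁ ≤ a) (h2 : a < r.x₂) (h3 : r.y₁ < b) (h4 : b ≤ r.y₂)
    (h1' : r'.x₁ ≤ a) (h2' : a < r'.x₂) (h3' : r'.y₁ < b) (h4' : b ≤ r'.y₂) : r = r' := by
  obtain ⟨b', h7, h8⟩ := exists_between (max_lt h3 h3')
  rw [max_lt_iff] at h7
  exact h.eq_of_mem_upper hr hr' h1 h2 h7.1.le (h8.trans_le h4) h1' h2' h7.2.le (h8.trans_le h4')

/-- The ways in which a piece `r` can be charged to the `j`-th square. At most one piece is charged
to a given square in a given way (`charged_unique`), and every piece is charged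
(`exists_charged`). -/
def Charged (Q : SquareSeq) (r : AARect) (j : ℕ) : Fin 6 → Prop
  -- `r` is the first piece of the square.
  | 0 => Q.IsPiece j r ∧ r.x₁ = Q.x j
  -- The lower left vertex of `r` is where the bottom side of the square emerges from the squares
  -- with priority.
  | 1 => Q.IsPiece j r ∧ r.y₁ = Q.y j ∧
      ∃ k < Q.len, Q.Prec k j ∧ Q.x k < r.x₁ ∧ r.x₁ ≤ Q.right k ∧ Q.y k ≤ r.y₁ ∧ r.y₁ < Q.top k
  -- The lower left vertex of `r` is where the top side of the square, in its course from left to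
  -- right, starts or emerges from the squares with priority.
  | 2 => r.y₁ = Q.top j ∧ Q.x j ≤ r.x₁ ∧ r.x₁ < Q.right j ∧
      (∀ k < Q.len, Q.Prec k j → Q.x k ≤ r.x₁ → r.x₁ < Q.right k →
        ¬ (Q.y k ≤ r.y₁ ∧ r.y₁ < Q.top k)) ∧
      (r.x₁ = Q.x j ∨ ∃ k < Q.len, Q.Prec k j ∧ Q.x k < r.x₁ ∧ r.x₁ ≤ Q.right k ∧
        Q.y k ≤ r.y₁ ∧ r.y₁ < Q.top k)
  -- The lower left vertex of `r` is where the right side of the square, in its course from bottom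
  -- to top, emerges from the squares with priority.
  | 3 => r.x₁ = Q.right j ∧ Q.y j ≤ r.y₁ ∧ r.y₁ < Q.top j ∧
      (∀ k < Q.len, Q.Prec k j → Q.x k ≤ r.x₁ → r.x₁ < Q.right k →
        ¬ (Q.y k ≤ r.y₁ ∧ r.y₁ < Q.top k)) ∧
      ∃ k < Q.len, Q.Prec k j ∧ Q.x k ≤ r.x₁ ∧ r.x₁ < Q.right k ∧
        Q.y k < r.y₁ ∧ r.y₁ ≤ Q.top k
  -- The lower left corner of the square is on the left side of `r`, above the lower end.
  | 4 => r.x₁ = Q.x j ∧ r.y₁ < Q.y j ∧ Q.y j ≤ r.y₂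
  -- The lower right corner of the square is on the left side of `r`, above the lower end.
  | 5 => r.x₁ = Q.right j ∧ r.y₁ < Q.y j ∧ Q.y j ≤ r.y₂

/-- A horizontal side of the `j`-th square emerges only once, from left to right, from the squares
with priority: such a square that ends at `a'` contains the whole part of the side before
`a'`, since it is at least as large as the `j`-th one. -/
theorem leave_right_le {a a' b : ℝ} (ha : Q.x j ≤ a) (ha' : a' < Q.right j)
    (hfree : ∀ k < Q.len, Q.Prec k j → Q.x k ≤ a → a < Q.right k →
      ¬ (Q.y k ≤ b ∧ b < Q.top k))
    (hfree' : ∀ k < Q.len, Q.Prec k j → Q.x k ≤ a' → a' < Q.right k →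
      ¬ (Q.y k ≤ b ∧ b < Q.top k))
    (h : a' = Q.x j ∨ ∃ k < Q.len, Q.Prec k j ∧ Q.x k < a' ∧ a' ≤ Q.right k ∧
      Q.y k ≤ b ∧ b < Q.top k) : a' ≤ a := by
  rcases h with h | ⟨k, hk, hp, h1, h2, h3⟩
  · exact h.trans_le ha
  by_contra hlt
  have h4 : Q.right k ≤ a' := by
    by_contra h4
    exact hfree' k hk hp h1.le (not_le.1 h4) h3
  refine hfree k hk hp ?_ ((not_le.1 hlt).trans_le h2) h3
  have := hp.1
  unfold right at h4 ha'
  linarith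

/-- A vertical side of the `j`-th square emerges only once, from bottom to top, from the squares
with priority. -/
theorem leave_top_le {a b b' : ℝ} (hb : Q.y j ≤ b) (hb' : b' < Q.top j)
    (hfree : ∀ k < Q.len, Q.Prec k j → Q.x k ≤ a → a < Q.right k →
      ¬ (Q.y k ≤ b ∧ b < Q.top k))
    (hfree' : ∀ k < Q.len, Q.Prec k j → Q.x k ≤ a → a < Q.right k →
      ¬ (Q.y k ≤ b' ∧ b' < Q.top k))
    (h : ∃ k < Q.len, Q.Prec k j ∧ Q.x k ≤ a ∧ a < Q.right k ∧
      Q.y k < b' ∧ b' ≤ Q.top k) : b' ≤ b := by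
  obtain ⟨k, hk, hp, h1, h2, h3, h4⟩ := h
  by_contra hlt
  have h5 : Q.top k ≤ b' := by
    by_contra h5
    exact hfree' k hk hp h1 h2 ⟨h3.le, not_le.1 h5⟩
  refine hfree k hk hp h1 h2 ⟨?_, (not_le.1 hlt).trans_le h4⟩
  have := hp.1
  unfold top at h5 hb'
  linarith

/-- No square with priority contains the quarter disk to the upper right of the lower left vertex
of a piece. -/
theorem IsPiece.vertex_free {r : AARect} (h : Q.IsPiece i r) (k : ℕ) (hk : k < Q.len)
    (hp : Q.Prec k i) (h1 : Q.x k ≤ r.x₁) (h2 : r.x₁ < Q.right k) :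
    ¬ (Q.y k ≤ r.y₁ ∧ r.y₁ < Q.top k) :=
  Blocks.not_mem_free (Q := Q) (i := i) (z := r.x₁) ⟨hp, h1, h2⟩ hk h.low_left.le
    (h.high_left ▸ r.hy)

theorem IsPartial.charged_unique {R : List AARect} {c : ℝ} (h : Q.IsPartial i c R)
    {r r' : AARect} (hr : r ∈ R) (hr' : r' ∈ R) {l : Fin 6} (hl : Q.Charged r j l)
    (hl' : Q.Charged r' j l) : r = r' := by
  have key (h1 : r.x₁ = r'.x₁) (h2 : r.y₁ = r'.y₁) : r = r' :=
    h.eq_of_mem_upper hr hr' le_rfl r.hx le_rfl r.hy h1.ge (h1 ▸ r'.hx) h2.ge (h2 ▸ r'.hy)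
  have key' (h1 : r.x₁ = r'.x₁) {b : ℝ} (h2 : r.y₁ < b ∧ b ≤ r.y₂)
      (h3 : r'.y₁ < b ∧ b ≤ r'.y₂) : r = r' :=
    h.eq_of_mem_lower hr hr' le_rfl r.hx h2.1 h2.2 h1.ge (h1 ▸ r'.hx) h3.1 h3.2
  match l, hl, hl' with
  | 0, ⟨hp, h1⟩, ⟨hp', h1'⟩ =>
    have h2 := h1.trans h1'.symm
    exact key h2 (by rw [← hp.low_left, ← hp'.low_left, h2])
  | 1, ⟨hp, h1, h2⟩, ⟨hp', h1', h2'⟩ =>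
    have hy := h1.trans h1'.symm
    have hf := hp.vertex_free
    have hf' := hp'.vertex_free
    rw [← hy] at hf' h2'
    exact key (le_antisymm
      (leave_right_le hp'.x_le (r.hx.trans_le hp.le_right) hf' hf (Or.inr h2))
      (leave_right_le hp.x_le (r'.hx.trans_le hp'.le_right) hf hf' (Or.inr h2'))) hy
  | 2, ⟨h1, h2, h3, h4, h5⟩, ⟨h1', h2', h3', h4', h5'⟩ =>
    have hy := h1.trans h1'.symm
    rw [← hy] at h4' h5'
    exact key (le_antisymm (leave_right_le h2' h3 h4' h4 h5) (leave_right_le h2 h3' h4 h4' h5')) hy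
  | 3, ⟨h1, h2, h3, h4, h5⟩, ⟨h1', h2', h3', h4', h5'⟩ =>
    have hx := h1.trans h1'.symm
    rw [← hx] at h4' h5'
    exact key hx (le_antisymm (leave_top_le h2' h3 h4' h4 h5) (leave_top_le h2 h3' h4 h4' h5'))
  | 4, ⟨h1, h2⟩, ⟨h1', h2'⟩ => exact key' (h1.trans h1'.symm) h2 h2'
  | 5, ⟨h1, h2⟩, ⟨h1', h2'⟩ => exact key' (h1.trans h1'.symm) h2 h2'

/-- If only the upper end of the free part changes at the left side of a piece, then this happens at
a lower corner of a square. -/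
theorem IsPiece.exists_charged_of_high_ne {r : AARect} (h : Q.IsPiece i r) (hz : z < r.x₁)
    (hgap : ∀ e ∈ Q.coords, z < e → r.x₁ ≤ e) (hlow : r.y₁ < Q.high i z)
    (hne : Q.high i z ≠ r.y₂) : ∃ j < Q.len, ∃ l, Q.Charged r j l := by
  rcases lt_or_gt_of_ne hne with hlt | hlt
  · rcases SquareSeq.high_eq (Q := Q) i z with h1 | ⟨k, hk, ⟨hp, h2, h3⟩, h4, h5⟩
    · have := high_le_top (Q := Q) (i := i) (z := r.x₁)
      rw [h.high_left] at this
      linarith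
    · refine ⟨k, hk, 5, le_antisymm (hgap _ (right_mem_coords hk) h3) ?_, by linarith, by linarith⟩
      by_contra h6
      have := Blocks.high_le_y (Q := Q) (i := i) ⟨hp, h2.trans hz.le, not_le.1 h6⟩ hk h4
      rw [h.high_left] at this
      linarith
  · rcases SquareSeq.high_eq (Q := Q) i r.x₁ with h1 | ⟨k, hk, ⟨hp, h2, h3⟩, h4, h5⟩
    · have := high_le_top (Q := Q) (i := i) (z := z)
      rw [h.high_left] at h1
      linarith
    · rw [h.high_left] at h5
      have := r.hy
      refine ⟨k, hk, 4, le_antisymm ?_ h2, by linarith, by linarith⟩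
      by_contra h6
      have h7 : Q.x k ≤ z := by
        by_contra h7
        exact h6 (hgap _ (x_mem_coords hk) (not_le.1 h7))
      have := Blocks.high_le_y (Q := Q) (i := i) ⟨hp, h7, hz.trans h3⟩ hk h4
      linarith

theorem IsPiece.exists_charged {r : AARect} (h : Q.IsPiece i r) :
    ∃ j < Q.len, ∃ l, Q.Charged r j l := by
  rcases h.isBreak with h0 | ⟨z, -, hz, hgap, hne⟩
  · exact ⟨i, h.lt_len, 0, h, h0⟩
  rw [h.low_left, h.high_left] at hne
  have hy := r.hy
  have hrt := h.high_left ▸ high_le_top (Q := Q) (i := i) (z := r.x₁)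
  have hyr := h.low_left ▸ y_le_low (Q := Q) (i := i) (z := r.x₁)
  have hxk {k : ℕ} (hk : k < Q.len) (h1 : z < Q.right k) : r.x₁ ≤ Q.right k :=
    hgap _ (right_mem_coords hk) h1
  by_cases hT : ∃ k < Q.len, Q.Prec k i ∧ Q.x k < r.x₁ ∧ r.x₁ ≤ Q.right k ∧
      Q.y k ≤ r.y₁ ∧ r.y₁ < Q.top k
  · rcases SquareSeq.low_eq (Q := Q) i r.x₁ with h1 | ⟨a, ha, ⟨hp, h2, h3⟩, h4, h5⟩
    · rw [h.low_left] at h1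
      exact ⟨i, h.lt_len, 1, h, h1, hT⟩
    · rw [h.low_left] at h5
      obtain ⟨k, hk, hkp, hk1, hk2, hk3, hk4⟩ := hT
      rcases prec_trichotomy (Q := Q) (i := k) (j := a)
        (by rintro rfl; linarith) with h6 | h6
      · exact ⟨a, ha, 2, h5, h2, h3, fun k' hk' hp' => h.vertex_free k' hk' (hp'.trans hp),
          Or.inr ⟨k, hk, h6, hk1, hk2, hk3, hk4⟩⟩
      · refine ⟨k, hk, 3, le_antisymm hk2 ?_, hk3, hk4,
          fun k' hk' hp' => h.vertex_free k' hk' (hp'.trans hkp), a, ha, h6, h2, h3, ?_, h5.le⟩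
        · by_contra h7
          exact h.vertex_free k hk hkp hk1.le (not_le.1 h7) ⟨hk3, hk4⟩
        · linarith [y_lt_top ha]
  · have hle : Q.low i z ≤ r.y₁ := by
      refine low_le_iff.2 ⟨hyr, fun k hk hb hk1 => ?_⟩
      by_contra h1
      exact hT ⟨k, hk, hb.1, hb.2.1.trans_lt hz, hxk hk hb.2.2, hk1.trans hyr, not_le.1 h1⟩
    have hhigh : r.y₁ < Q.high i z := by
      rcases SquareSeq.high_eq (Q := Q) i z with h1 | ⟨k, hk, ⟨hp, h2, h3⟩, h4, h5⟩
      · linarith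
      · rw [h5]
        by_contra h6
        refine hT ⟨k, hk, hp, h2.trans_lt hz, hxk hk h3, not_lt.1 h6, ?_⟩
        have := hp.1
        unfold top at *
        linarith
    rcases SquareSeq.low_eq (Q := Q) i r.x₁ with h1 | ⟨a, ha, ⟨hp, h2, h3⟩, h4, h5⟩
    · rw [h.low_left] at h1
      have := y_le_low (Q := Q) (i := i) (z := z)
      exact h.exists_charged_of_high_ne hz hgap hhigh
        fun h6 => hne ⟨by linarith, h6.symm⟩
    · rw [h.low_left] at h5
      by_cases hax : r.x₁ = Q.x a
      · exact ⟨a, ha, 2, h5, h2, h3, fun k' hk' hp' => h.vertex_free k' hk' (hp'.trans hp),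
          Or.inl hax⟩
      · have h7 : Q.x a ≤ z := by
          by_contra h7
          exact hax (le_antisymm (hgap _ (x_mem_coords ha) (not_le.1 h7)) h2)
        have := Blocks.top_le_low (Q := Q) (i := i) ⟨hp, h7, hz.trans h3⟩ ha h4
        exact h.exists_charged_of_high_ne hz hgap hhigh
          fun h6 => hne ⟨by linarith, h6.symm⟩

theorem IsPartial.nodup {R : List AARect} {c : ℝ} (h : Q.IsPartial i c R) : R.Nodup := by
  refine h.disjoint.imp fun {r r'} hd => ?_
  rintro rfl
  rw [disjoint_self, r.interior_toSet] at hd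
  exact ((Set.nonempty_Ioo.2 r.hx).prod (Set.nonempty_Ioo.2 r.hy)).ne_empty hd

theorem IsPartial.length_le {R : List AARect} {c : ℝ} (h : Q.IsPartial i c R) :
    R.length ≤ 6 * Q.len := by
  classical
  have hex : ∀ r : {r // r ∈ R}, ∃ p : Fin Q.len × Fin 6, Q.Charged r.1 p.1 p.2 := by
    rintro ⟨r, hr⟩
    obtain ⟨_, -, hp⟩ := h.piece r hr
    obtain ⟨j, hj, l, hl⟩ := hp.exists_charged
    exact ⟨(⟨j, hj⟩, l), hl⟩
  choose f hf using hex
  have hinj : Function.Injective f := fun r r' hrr => by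
    refine Subtype.ext (h.charged_unique r.2 r'.2 (hf r) ?_)
    rw [hrr]
    exact hf r'
  have hcard := Fintype.card_le_of_injective f hinj
  rw [Fintype.card_prod, Fintype.card_fin, Fintype.card_fin, mul_comm] at hcard
  refine le_trans (le_of_eq ?_) hcard
  rw [Fintype.card_of_subtype R.toFinset (by simp), List.toFinset_card_of_nodup h.nodup]

/-! ### The union of the pieces -/

theorem IsPartial.subset {R : List AARect} {c : ℝ} (h : Q.IsPartial i c R) {r : AARect}
    (hr : r ∈ R) : ∃ j < Q.len,
      r.toSet ⊆ Set.Icc (Q.x j) (Q.right j) ×ˢ Set.Icc (Q.y j) (Q.top j) := by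
  obtain ⟨j, -, hp⟩ := h.piece r hr
  refine ⟨j, hp.lt_len, Set.prod_mono (Set.Icc_subset_Icc hp.x_le hp.le_right)
    (Set.Icc_subset_Icc ?_ ?_)⟩
  · exact hp.low_left ▸ y_le_low
  · exact hp.high_left ▸ high_le_top

/-- A point lies in the free part of the square that has the highest priority among those
containing it. -/
theorem IsPartial.half_open_subset {R : List AARect} {c : ℝ} (h : Q.IsPartial Q.len c R)
    (hj : j < Q.len) :
    Set.Ico (Q.x j) (Q.right j) ×ˢ Set.Ico (Q.y j) (Q.top j) ⊆ ⋃ r ∈ R, r.toSet := by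
  classical
  rintro ⟨a, b⟩ ⟨⟨h1, h2⟩, h3, h4⟩
  simp only at h1 h2 h3 h4
  have hwf : ∃ k ∈ (Finset.range Q.len).filter
      (fun k => Q.x k ≤ a ∧ a < Q.right k ∧ Q.y k ≤ b ∧ b < Q.top k),
      ∀ m ∈ (Finset.range Q.len).filter
        (fun k => Q.x k ≤ a ∧ a < Q.right k ∧ Q.y k ≤ b ∧ b < Q.top k), ¬ Q.Prec m k := by
    have : IsTrans ℕ Q.Prec := ⟨fun _ _ _ => Prec.trans⟩
    have : Std.Irrefl Q.Prec := ⟨fun _ => prec_irrefl⟩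
    have : IsStrictOrder ℕ Q.Prec := {}
    have hw := (Finset.finite_toSet ((Finset.range Q.len).filter
      (fun k => Q.x k ≤ a ∧ a < Q.right k ∧ Q.y k ≤ b ∧ b < Q.top k))).wellFoundedOn
        (r := Q.Prec)
    obtain ⟨k, hk⟩ := hw.has_min Set.univ ⟨⟨j, by simp [hj, h1, h2, h3, h4]⟩, trivial⟩
    exact ⟨k.1, k.2, fun m hm => hk.2 ⟨m, hm⟩ trivial⟩
  obtain ⟨k, hk, hmin⟩ := hwf
  simp only [Finset.mem_filter, Finset.mem_range, and_imp] at hk hmin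
  obtain ⟨hk, k1, k2, k3, k4⟩ := hk
  have hlow : Q.low k a ≤ b := by
    refine low_le_iff.2 ⟨k3, fun m hm hb hy => ?_⟩
    by_contra hc
    exact hmin m hm hb.2.1 hb.2.2 (hy.trans k3) (not_le.1 hc) hb.1
  have hhigh : b < Q.high k a := by
    rcases SquareSeq.high_eq (Q := Q) k a with h5 | ⟨m, hm, hb, hy, h5⟩
    · exact h5 ▸ k4
    · rw [h5]
      by_contra hc
      refine hmin m hm hb.2.1 hb.2.2 (not_lt.1 hc) ?_ hb.1
      have := hb.1.1
      unfold top at *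
      linarith
  obtain ⟨r, hr, r1, r2, r3, r4⟩ := h.cover k hk a (Or.inl hk) k1 k2 (hlow.trans_lt hhigh)
  exact Set.mem_biUnion hr ⟨⟨r1, r2.le⟩, r3 ▸ hlow, r4 ▸ hhigh.le⟩

theorem IsPartial.iUnion_eq {R : List AARect} {c : ℝ} (h : Q.IsPartial Q.len c R) :
    (⋃ r ∈ R, r.toSet) =
      ⋃ j ∈ Finset.range Q.len, Set.Icc (Q.x j) (Q.right j) ×ˢ Set.Icc (Q.y j) (Q.top j) := by
  apply Set.Subset.antisymm
  · refine Set.iUnion₂_subset fun r hr => ?_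
    obtain ⟨j, hj, hsub⟩ := h.subset hr
    exact hsub.trans (Set.subset_biUnion_of_mem (u := fun j =>
      Set.Icc (Q.x j) (Q.right j) ×ˢ Set.Icc (Q.y j) (Q.top j)) (Finset.mem_range.2 hj))
  · refine Set.iUnion₂_subset fun j hj => ?_
    rw [Finset.mem_range] at hj
    rw [← closure_Ico (x_lt_right hj).ne, ← closure_Ico (y_lt_top hj).ne, ← closure_prod_eq]
    refine closure_minimal (h.half_open_subset hj) ?_
    exact R.finite_toSet.isClosed_biUnion fun r _ => isClosed_Icc.prod isClosed_Icc

end SquareSeq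

/-! ### Running time bounds for programs of the real RAM -/

namespace RealRAM

/-- The program `p`, started in `s`, halts after at most `T` steps in a state satisfying `P`. -/
def Runs (p : Prog) (T : ℕ) (s : State) (P : State → Prop) : Prop :=
  ∃ t s', Run p s t s' ∧ t ≤ T ∧ P s'

theorem nat_setNat (s : State) (a i v b : ℕ) :
    (s.setNat a i v).nat b = if b = a then Function.update (s.nat a) i v else s.nat b := by
  simp [State.setNat, Function.update_apply]

theorem real_setNat (s : State) (a i v : ℕ) : (s.setNat a i v).real = s.real := rfl

theorem nat_setReal (s : State) (a i : ℕ) (v : ℝ) : (s.setReal a i v).nat = s.nat := rfl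

theorem real_setReal (s : State) (a i : ℕ) (v : ℝ) (b : ℕ) :
    (s.setReal a i v).real b = if b = a then Function.update (s.real a) i v else s.real b := by
  simp [State.setReal, Function.update_apply]

variable {p q : Prog} {T T' : ℕ} {s : State} {P P' : State → Prop}

theorem Runs.mono (h : Runs p T s P) (hT : T ≤ T') (hP : ∀ s, P s → P' s) : Runs p T' s P' := by
  obtain ⟨t, s', h1, h2, h3⟩ := h
  exact ⟨t, s', h1, h2.trans hT, hP _ h3⟩

theorem Runs.skip (hT : 1 ≤ T) (h : P s) : Runs .skip T s P := ⟨1, s, .skip s, hT, h⟩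

theorem Runs.setNat {a : ℕ} {i e : NatExpr} (hT : i.cost + e.cost + 1 ≤ T)
    (h : P (s.setNat a (i.eval s) (e.eval s))) : Runs (.setNat a i e) T s P :=
  ⟨_, _, .setNat a i e s, hT, h⟩

theorem Runs.setReal {a : ℕ} {i : NatExpr} {e : RealExpr} (hT : i.cost + e.cost + 1 ≤ T)
    (h : P (s.setReal a (i.eval s) (e.eval s))) : Runs (.setReal a i e) T s P :=
  ⟨_, _, .setReal a i e s, hT, h⟩

theorem Runs.seq (h : Runs p T s fun s' => Runs q T' s' P) : Runs (.seq p q) (T + T') s P := by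
  obtain ⟨t, s', h1, h2, t', s'', h3, h4, h5⟩ := h
  exact ⟨_, _, .seq h1 h3, by omega, h5⟩

theorem Runs.ite {b : Cond} (T : ℕ) (hT : b.cost + 1 + T ≤ T') (h1 : b.Holds s → Runs p T s P)
    (h2 : ¬ b.Holds s → Runs q T s P) : Runs (.ite b p q) T' s P := by
  by_cases hb : b.Holds s
  · obtain ⟨t, s', h3, h4, h5⟩ := h1 hb
    exact ⟨_, _, .ite_true hb h3, by omega, h5⟩
  · obtain ⟨t, s', h3, h4, h5⟩ := h2 hb
    exact ⟨_, _, .ite_false hb h3, by omega, h5⟩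

/-- A loop with the invariant `P`, the variant `V`, and a body that takes at most `T` steps. -/
theorem Runs.loop {b : Cond} (V : State → ℕ)
    (hbody : ∀ s, P s → b.Holds s → Runs p T s fun s' => P s' ∧ V s' < V s) (h : P s) :
    Runs (.loop b p) ((b.cost + 1 + T) * V s + (b.cost + 1)) s
      fun s' => P s' ∧ ¬ b.Holds s' := by
  induction hv : V s using Nat.strong_induction_on generalizing s with
  | _ v ih =>
    by_cases hb : b.Holds s
    · obtain ⟨t, s', h1, h2, h3, h4⟩ := hbody s h hb
      obtain ⟨t', s'', h5, h6, h7⟩ := ih (V s') (hv ▸ h4) h3 rfl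
      refine ⟨_, _, .loop_true hb h1 h5, ?_, h7⟩
      have : (b.cost + 1 + T) * (V s' + 1) ≤ (b.cost + 1 + T) * v :=
        Nat.mul_le_mul_left _ (by omega)
      rw [Nat.mul_succ] at this
      omega
    · exact ⟨_, _, .loop_false hb, by omega, h, hb⟩

/-- The scalar variable in the `a`-th array of natural numbers. -/
abbrev natVar (a : ℕ) : NatExpr := .get a (.const 0)

/-- The scalar variable in the `a`-th array of real numbers. -/
abbrev realVar (a : ℕ) : RealExpr := .get a (.const 0)

/-- Execute `p` with the scalar natural number variable `k` running from `0` up to, but excluding,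
the value of the variable `b`. -/
abbrev forLoop (k b : ℕ) (p : Prog) : Prog :=
  .seq (.setNat k (.const 0) (.const 0))
    (.loop (.not (.natLe (natVar b) (natVar k)))
      (.seq p (.setNat k (.const 0) (.add (natVar k) (.const 1)))))

/-- `I m` is the invariant before the round in which the counter has the value `m`. -/
theorem Runs.forLoop {k b N : ℕ} (I : ℕ → State → Prop)
    (hI : ∀ m s, I m s → s.nat k 0 = m ∧ s.nat b 0 = N)
    (hbody : ∀ m < N, ∀ s, I m s →
      Runs p T s fun s' => s'.nat k 0 = m ∧ I (m + 1) (s'.setNat k 0 (m + 1)))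
    (h : I 0 (s.setNat k 0 0)) : Runs (forLoop k b p) ((T + 20) * N + 20) s (I N) := by
  have hloop := Runs.loop (s := s.setNat k 0 0)
    (b := .not (.natLe (natVar b) (natVar k)))
    (p := .seq p (.setNat k (.const 0) (.add (natVar k) (.const 1)))) (T := T + 6)
    (P := fun s => ∃ m ≤ N, I m s) (fun s => N - s.nat k 0) ?_ ⟨0, N.zero_le, h⟩
  · refine Runs.mono (Runs.seq (T := 3) (Runs.setNat (by decide) hloop)) ?_ ?_
    · have : N - (s.setNat k 0 0).nat k 0 = N := by simp [nat_setNat]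
      simp only [this, Cond.cost, NatExpr.cost]
      have : (1 + 1 + (1 + 1) + 1 + 1 + 1 + (T + 6)) * N ≤ (T + 20) * N :=
        Nat.mul_le_mul_right _ (by omega)
      omega
    · rintro s' ⟨⟨m, hm, hs'⟩, hb⟩
      obtain ⟨h1, h2⟩ := hI m s' hs'
      simp only [Cond.Holds, NatExpr.eval, h1, h2, not_not] at hb
      rwa [le_antisymm hb hm]
  · rintro s ⟨m, hm, hs⟩ hb
    obtain ⟨h1, h2⟩ := hI m s hs
    simp only [Cond.Holds, NatExpr.eval, h1, h2, not_le] at hb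
    refine Runs.seq ((hbody m hb s hs).mono le_rfl fun s' ⟨h3, h4⟩ => ?_)
    refine Runs.setNat (by simp [NatExpr.cost]) ⟨⟨m + 1, hb, ?_⟩, ?_⟩
    · simpa only [NatExpr.eval, h3] using h4
    · simp only [NatExpr.eval, nat_setNat, if_true, Function.update_self, h1, h3]
      omega

/-! ### The program -/

/-!
The natural number variables are `0`: the number of squares, `1`: the number of rectangles found
so far, `2` and `3`: loop counters, `4`: the current square. The real arrays `0`, `1`, `2` hold
the squares, `4`, `5`, `6`, `7` hold the rectangles found so far. The real variables are
`8`: the argument of `boundsProg`, `9` and `10`: its two results, `11`: the left side of the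
current piece, `12` and `13`: its lower and upper side, `14`: the candidate for its right
side.
-/

/-- Compute `low` and `high` for the current square. -/
def boundsProg : Prog :=
  .seq (.setReal 9 (.const 0) (.get 1 (natVar 4))) <|
  .seq (.setReal 10 (.const 0) (.add (.get 1 (natVar 4)) (.get 2 (natVar 4)))) <|
  forLoop 2 0 <|
    .ite (.and
        (.and (.realLe (.get 2 (natVar 4)) (.get 2 (natVar 2)))
          (.not (.and (.realLe (.get 2 (natVar 2)) (.get 2 (natVar 4)))
            (.natLe (natVar 4) (natVar 2)))))
        (.and (.realLe (.get 0 (natVar 2)) (realVar 8))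
          (.not (.realLe (.add (.get 0 (natVar 2)) (.get 2 (natVar 2))) (realVar 8)))))
      (.ite (.realLe (.get 1 (natVar 2)) (.get 1 (natVar 4)))
        (.ite (.realLe (realVar 9) (.add (.get 1 (natVar 2)) (.get 2 (natVar 2))))
          (.setReal 9 (.const 0) (.add (.get 1 (natVar 2)) (.get 2 (natVar 2)))) .skip)
        (.ite (.realLe (realVar 10) (.get 1 (natVar 2))) .skip
          (.setReal 10 (.const 0) (.get 1 (natVar 2)))))
      .skip

/-- Replace the candidate for the right side of the current piece by the value of variable `8` if
the free part of the columns has changed there. -/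
def tryProg : Prog :=
  .seq boundsProg <|
  .ite (.and
      (.and (.not (.realLe (realVar 8) (realVar 11))) (.not (.realLe (realVar 14) (realVar 8))))
      (.not (.and
        (.and (.realLe (realVar 9) (realVar 12)) (.realLe (realVar 12) (realVar 9)))
        (.and (.realLe (realVar 10) (realVar 13)) (.realLe (realVar 13) (realVar 10))))))
    (.setReal 14 (.const 0) (realVar 8)) .skip

/-- Find the right side of the current piece. -/
def nextProg : Prog :=
  .seq (.setReal 14 (.const 0) (.add (.get 0 (natVar 4)) (.get 2 (natVar 4)))) <|
  forLoop 3 0 <|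
    .seq (.setReal 8 (.const 0) (.get 0 (natVar 3))) <|
    .seq tryProg <|
    .seq (.setReal 8 (.const 0) (.add (.get 0 (natVar 3)) (.get 2 (natVar 3)))) tryProg

/-- Append the current piece to the list of rectangles. -/
def storeProg : Prog :=
  .seq (.setReal 4 (natVar 1) (realVar 11)) <|
  .seq (.setReal 5 (natVar 1) (realVar 14)) <|
  .seq (.setReal 6 (natVar 1) (realVar 12)) <|
  .seq (.setReal 7 (natVar 1) (realVar 13)) <|
  .setNat 1 (.const 0) (.add (natVar 1) (.const 1))

/-- Process the current piece, and proceed to its right side. -/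
def pieceProg : Prog :=
  .seq (.setReal 8 (.const 0) (realVar 11)) <|
  .seq boundsProg <|
  .seq (.setReal 12 (.const 0) (realVar 9)) <|
  .seq (.setReal 13 (.const 0) (realVar 10)) <|
  .seq nextProg <|
  .seq (.ite (.realLe (realVar 13) (realVar 12)) .skip storeProg) <|
  .setReal 11 (.const 0) (realVar 14)

/-- Find the pieces of the current square from left to right. -/
def sweepProg : Prog :=
  .seq (.setReal 11 (.const 0) (.get 0 (natVar 4))) <|
  .loop (.not (.realLe (.add (.get 0 (natVar 4)) (.get 2 (natVar 4))) (realVar 11))) pieceProg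

/-- Copy the list of rectangles to where the output is expected. -/
def copyProg : Prog :=
  .seq (forLoop 3 1 <|
    .seq (.setReal 0 (natVar 3) (.get 4 (natVar 3))) <|
    .seq (.setReal 1 (natVar 3) (.get 5 (natVar 3))) <|
    .seq (.setReal 2 (natVar 3) (.get 6 (natVar 3))) <|
    .setReal 3 (natVar 3) (.get 7 (natVar 3))) <|
  .setNat 0 (.const 0) (natVar 1)

/-- The program that decomposes the union of the squares. -/
def mainProg : Prog :=
  .seq (.setNat 1 (.const 0) (.const 0)) <| .seq (forLoop 4 0 sweepProg) copyProg

/-! ### Correctness of the program -/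

/-- The memory holds the family `Q` of squares as input. -/
structure Loaded (Q : SquareSeq) (s : State) : Prop where
  len : s.nat 0 0 = Q.len
  x : s.real 0 = Q.x
  y : s.real 1 = Q.y
  w : s.real 2 = Q.w

/-- The memory holds the list `R` of rectangles as intermediate result. -/
structure Stored (s : State) (R : List AARect) : Prop where
  length : s.nat 1 0 = R.length
  get : ∀ (j : ℕ) (hj : j < R.length),
    s.real 4 j = R[j].x₁ ∧ s.real 5 j = R[j].x₂ ∧ s.real 6 j = R[j].y₁ ∧ s.real 7 j = R[j].y₂

variable {Q : SquareSeq} {R : List AARect}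

theorem Loaded.congr {s' : State} (h : Loaded Q s) (h1 : s'.nat 0 = s.nat 0)
    (h2 : ∀ a < 3, s'.real a = s.real a) : Loaded Q s' where
  len := h1 ▸ h.len
  x := (h2 0 (by omega)).trans h.x
  y := (h2 1 (by omega)).trans h.y
  w := (h2 2 (by omega)).trans h.w

theorem Stored.congr {s' : State} (h : Stored s R) (h1 : s'.nat 1 = s.nat 1)
    (h2 : ∀ a, 4 ≤ a → a < 8 → s'.real a = s.real a) : Stored s' R where
  length := h1 ▸ h.length
  get j hj := by
    rw [h2 4 (by omega) (by omega), h2 5 (by omega) (by omega), h2 6 (by omega) (by omega),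
      h2 7 (by omega) (by omega)]
    exact h.get j hj

theorem runs_boundsProg (hs : Loaded Q s) :
    Runs boundsProg (100 * Q.len + 50) s fun s' =>
      (∀ a ≠ 2, s'.nat a = s.nat a) ∧ (∀ a, a ≠ 9 → a ≠ 10 → s'.real a = s.real a) ∧
      s'.real 9 0 = Q.low (s.nat 4 0) (s.real 8 0) ∧
      s'.real 10 0 = Q.high (s.nat 4 0) (s.real 8 0) := by
  set i := s.nat 4 0 with hi
  set z := s.real 8 0 with hz
  refine Runs.mono (T := 10 + (15 + ((80 + 20) * Q.len + 20)))
    (Runs.seq (Runs.setReal (by decide) (Runs.seq (Runs.setReal (by decide)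
      (Runs.forLoop (T := 80) (N := Q.len) (fun m s' =>
        (∀ a ≠ 2, s'.nat a = s.nat a) ∧ (∀ a, a ≠ 9 → a ≠ 10 → s'.real a = s.real a) ∧
        s'.real 9 0 = Q.lowAux i z m ∧ s'.real 10 0 = Q.highAux i z m ∧ s'.nat 2 0 = m)
        ?_ ?_ ?_))))) (by omega) ?_
  · rintro m s' ⟨h1, -, -, -, h2⟩
    exact ⟨h2, by rw [h1 0 (by decide), hs.len]⟩
  · rintro m - s' ⟨h1, h2, h3, h4, h5⟩
    have hx : s'.real 0 = Q.x := by rw [h2 0 (by decide) (by decide), hs.x]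
    have hy : s'.real 1 = Q.y := by rw [h2 1 (by decide) (by decide), hs.y]
    have hw : s'.real 2 = Q.w := by rw [h2 2 (by decide) (by decide), hs.w]
    have hz' : s'.real 8 0 = z := by rw [h2 8 (by decide) (by decide)]
    have hi' : s'.nat 4 0 = i := by rw [h1 4 (by decide)]
    -- The memory contents after each of the four branches.
    have key (l u : ℝ) (hl : l = Q.lowAux i z (m + 1)) (hu : u = Q.highAux i z (m + 1))
        (s'' : State) (hn : s''.nat = s'.nat) (h9 : s''.real 9 0 = l) (h10 : s''.real 10 0 = u)
        (hr : ∀ a, a ≠ 9 → a ≠ 10 → s''.real a = s'.real a) :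
        s''.nat 2 0 = m ∧ (∀ a ≠ 2, (s''.setNat 2 0 (m + 1)).nat a = s.nat a) ∧
        (∀ a, a ≠ 9 → a ≠ 10 → (s''.setNat 2 0 (m + 1)).real a = s.real a) ∧
        (s''.setNat 2 0 (m + 1)).real 9 0 = Q.lowAux i z (m + 1) ∧
        (s''.setNat 2 0 (m + 1)).real 10 0 = Q.highAux i z (m + 1) ∧
        (s''.setNat 2 0 (m + 1)).nat 2 0 = m + 1 := by
      refine ⟨by rw [hn, h5], fun a ha => ?_, fun a ha ha' => ?_, ?_, ?_, ?_⟩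
      · rw [nat_setNat, if_neg ha, hn, h1 a ha]
      · rw [real_setNat, hr a ha ha', h2 a ha ha']
      · rw [real_setNat, h9, hl]
      · rw [real_setNat, h10, hu]
      · rw [nat_setNat, if_pos rfl, Function.update_self]
    refine Runs.ite 30 (by decide) (fun hb => ?_) (fun hb => ?_)
    · simp only [Cond.Holds, RealExpr.eval, NatExpr.eval, hx, hw, hz', hi', h5] at hb
      have hb' : Q.Blocks i z m := by
        simpa only [SquareSeq.Blocks, SquareSeq.Prec, SquareSeq.right, not_le] using hb
      refine Runs.ite 22 (by decide) (fun hc => ?_) (fun hc => ?_)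
      · simp only [Cond.Holds, RealExpr.eval, NatExpr.eval, hy, hi', h5] at hc
        have hl : Q.lowAux i z (m + 1) = max (Q.lowAux i z m) (Q.top m) := by
          rw [SquareSeq.lowAux, if_pos ⟨hb', hc⟩]
        have hu : Q.highAux i z (m + 1) = Q.highAux i z m := by
          rw [SquareSeq.highAux, if_neg fun h => h.2 hc]
        refine Runs.ite 10 (by decide) (fun hd => ?_) (fun hd => ?_)
        · refine Runs.setReal (by decide) ?_
          simp only [Cond.Holds, RealExpr.eval, NatExpr.eval, hy, hw, h5, h3] at hd ⊢
          refine key _ _ (hl.trans (max_eq_right hd)).symm hu.symm _ rfl ?_ ?_ ?_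
          · simp [real_setReal, SquareSeq.top]
          · simp [real_setReal, h4]
          · intro a ha _
            rw [real_setReal, if_neg ha]
        · refine Runs.skip (by decide) ?_
          simp only [Cond.Holds, RealExpr.eval, NatExpr.eval, hy, hw, h5, h3, not_le] at hd
          exact key _ _ (hl.trans (max_eq_left hd.le)).symm hu.symm _ rfl h3 h4
            fun _ _ _ => rfl
      · simp only [Cond.Holds, RealExpr.eval, NatExpr.eval, hy, hi', h5] at hc
        have hl : Q.lowAux i z (m + 1) = Q.lowAux i z m := by
          rw [SquareSeq.lowAux, if_neg fun h => hc h.2]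
        have hu : Q.highAux i z (m + 1) = min (Q.highAux i z m) (Q.y m) := by
          rw [SquareSeq.highAux, if_pos ⟨hb', hc⟩]
        refine Runs.ite 10 (by decide) (fun hd => ?_) (fun hd => ?_)
        · refine Runs.skip (by decide) ?_
          simp only [Cond.Holds, RealExpr.eval, NatExpr.eval, hy, h5, h4] at hd
          exact key _ _ hl.symm (hu.trans (min_eq_left hd)).symm _ rfl h3 h4
            fun _ _ _ => rfl
        · refine Runs.setReal (by decide) ?_
          simp only [Cond.Holds, RealExpr.eval, NatExpr.eval, hy, h5, h4, not_le] at hd ⊢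
          refine key _ _ hl.symm (hu.trans (min_eq_right hd.le)).symm _ rfl ?_ ?_ ?_
          · simp [real_setReal, h3]
          · simp [real_setReal]
          · intro a _ ha
            rw [real_setReal, if_neg ha]
    · simp only [Cond.Holds, RealExpr.eval, NatExpr.eval, hx, hw, hz', hi', h5] at hb
      have hb' : ¬ Q.Blocks i z m := by
        simpa only [SquareSeq.Blocks, SquareSeq.Prec, SquareSeq.right, not_le] using hb
      refine Runs.skip (by decide) (key _ _ ?_ ?_ _ rfl h3 h4 fun _ _ _ => rfl)
      · rw [SquareSeq.lowAux, if_neg fun h => hb' h.1]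
      · rw [SquareSeq.highAux, if_neg fun h => hb' h.1]
  · refine ⟨fun a ha => ?_, fun a ha ha' => ?_, ?_, ?_, ?_⟩
    · simp [nat_setNat, nat_setReal, ha]
    · simp [real_setNat, real_setReal, ha, ha']
    · simp [real_setNat, real_setReal, NatExpr.eval, RealExpr.eval, hs.y, SquareSeq.lowAux, hi]
    · simp [real_setNat, real_setReal, nat_setReal, NatExpr.eval, RealExpr.eval, hs.y, hs.w,
        SquareSeq.highAux, SquareSeq.top, hi]
    · simp [nat_setNat]
  · rintro s' ⟨h1, h2, h3, h4, -⟩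
    exact ⟨h1, h2, h3, h4⟩

/-- The memory during the search for the right side of the piece of the `i`-th square with left side
`c`. -/
structure AtPiece (Q : SquareSeq) (i : ℕ) (c : ℝ) (s : State) : Prop where
  loaded : Loaded Q s
  index : s.nat 4 0 = i
  left : s.real 11 0 = c
  low : s.real 12 0 = Q.low i c
  high : s.real 13 0 = Q.high i c

variable {i : ℕ} {c : ℝ}

theorem AtPiece.congr {s' : State} (h : AtPiece Q i c s)
    (h1 : ∀ a, a ≠ 2 → a ≠ 3 → s'.nat a = s.nat a)
    (h2 : ∀ a, a ≠ 8 → a ≠ 9 → a ≠ 10 → a ≠ 14 → s'.real a = s.real a) : AtPiece Q i c s' where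
  loaded := h.loaded.congr (h1 0 (by decide) (by decide))
    fun a ha => h2 a (by omega) (by omega) (by omega) (by omega)
  index := by rw [h1 4 (by decide) (by decide), h.index]
  left := by rw [h2 11 (by decide) (by decide) (by decide) (by decide), h.left]
  low := by rw [h2 12 (by decide) (by decide) (by decide) (by decide), h.low]
  high := by rw [h2 13 (by decide) (by decide) (by decide) (by decide), h.high]

theorem runs_tryProg {A : Finset ℝ} {d e : ℝ} (hs : AtPiece Q i c s) (he : s.real 8 0 = e)
    (heQ : e ∈ Q.coords) (hd : s.real 14 0 = d) (hA : Q.IsNext A i c d) :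
    Runs tryProg (100 * Q.len + 100) s fun s' =>
      (∀ a ≠ 2, s'.nat a = s.nat a) ∧
      (∀ a, a ≠ 9 → a ≠ 10 → a ≠ 14 → s'.real a = s.real a) ∧
      ∃ d', s'.real 14 0 = d' ∧ Q.IsNext (insert e A) i c d' := by
  refine Runs.mono (T := (100 * Q.len + 50) + 50) (Runs.seq
    ((runs_boundsProg hs.loaded).mono le_rfl ?_)) (by omega) fun _ h => h
  rintro s' ⟨h1, h2, h3, h4⟩
  rw [hs.index, he] at h3 h4
  have h8 : s'.real 8 0 = e := by rw [h2 8 (by decide) (by decide), he]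
  have h11 : s'.real 11 0 = c := by rw [h2 11 (by decide) (by decide), hs.left]
  have h12 : s'.real 12 0 = Q.low i c := by rw [h2 12 (by decide) (by decide), hs.low]
  have h13 : s'.real 13 0 = Q.high i c := by rw [h2 13 (by decide) (by decide), hs.high]
  have h14 : s'.real 14 0 = d := by rw [h2 14 (by decide) (by decide), hd]
  refine Runs.ite 10 (by decide) (fun hb => ?_) (fun hb => ?_)
  all_goals
    simp only [Cond.Holds, RealExpr.eval, NatExpr.eval, h3, h4, h8, h11, h12, h13, h14, not_le,
      ← le_antisymm_iff] at hb
  · refine Runs.setReal (by decide) ⟨h1, fun a ha ha' ha'' => ?_, e, ?_,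
      hA.insert_of_change heQ hb.1.1 hb.1.2 hb.2⟩
    · rw [real_setReal, if_neg ha'', h2 a ha ha']
    · simp [real_setReal, NatExpr.eval, RealExpr.eval, h8]
  · exact Runs.skip (by decide) ⟨h1, fun a ha ha' _ => h2 a ha ha', d, h14,
      hA.insert_of_not_change hb⟩

theorem runs_nextProg (hs : AtPiece Q i c s) (hi : i < Q.len) (hc : c < Q.right i) :
    Runs nextProg ((200 * Q.len + 300) * Q.len + 50) s fun s' =>
      (∀ a, a ≠ 2 → a ≠ 3 → s'.nat a = s.nat a) ∧
      (∀ a, a ≠ 8 → a ≠ 9 → a ≠ 10 → a ≠ 14 → s'.real a = s.real a) ∧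
      ∃ d, s'.real 14 0 = d ∧ Q.IsNext Q.coords i c d := by
  refine Runs.mono (T := 10 + ((200 * Q.len + 250 + 20) * Q.len + 20))
    (Runs.seq (Runs.setReal (by decide)
      (Runs.forLoop (T := 200 * Q.len + 250) (N := Q.len) (fun m s' =>
        s'.nat 3 0 = m ∧ (∀ a, a ≠ 2 → a ≠ 3 → s'.nat a = s.nat a) ∧
        (∀ a, a ≠ 8 → a ≠ 9 → a ≠ 10 → a ≠ 14 → s'.real a = s.real a) ∧
        ∃ A, (∀ j < m, Q.x j ∈ A ∧ Q.right j ∈ A) ∧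
          ∃ d, s'.real 14 0 = d ∧ Q.IsNext A i c d)
        ?_ ?_ ?_))) ?_ ?_
  · rintro m s' ⟨h1, h2, -⟩
    exact ⟨h1, by rw [h2 0 (by decide) (by decide), hs.loaded.len]⟩
  · rintro m hm s₀ ⟨h1, h2, h3, A, hA, d, hd, hnext⟩
    have hs₀ := hs.congr h2 h3
    refine Runs.mono (T := 10 + ((100 * Q.len + 100) + (10 + (100 * Q.len + 100))))
      (Runs.seq (Runs.setReal (by decide) (Runs.seq ((runs_tryProg (e := Q.x m) (d := d)
        (A := A) (i := i) (c := c) (Q := Q) ?_ ?_ (SquareSeq.x_mem_coords hm) ?_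
        hnext).mono le_rfl ?_)))) (by omega) fun _ h => h
    · refine hs₀.congr (fun a _ _ => rfl) fun a ha _ _ _ => ?_
      rw [real_setReal, if_neg ha]
    · simp [real_setReal, NatExpr.eval, RealExpr.eval, h1, hs₀.loaded.x]
    · simp [real_setReal, hd]
    rintro s₁ ⟨h4, h5, d₁, hd₁, hnext₁⟩
    have h4' : ∀ a, a ≠ 2 → a ≠ 3 → s₁.nat a = s₀.nat a := fun a ha _ => by
      rw [h4 a ha, nat_setReal]
    have h5' : ∀ a, a ≠ 8 → a ≠ 9 → a ≠ 10 → a ≠ 14 → s₁.real a = s₀.real a :=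
      fun a h8 h9 h10 h14 => by rw [h5 a h9 h10 h14, real_setReal, if_neg h8]
    have hs₁ := hs₀.congr h4' h5'
    have h6 : s₁.nat 3 0 = m := by rw [h4 3 (by decide), nat_setReal, h1]
    refine Runs.seq (Runs.setReal (by decide) ((runs_tryProg (e := Q.right m) (d := d₁)
        (A := insert (Q.x m) A) (i := i) (c := c) (Q := Q) ?_ ?_
        (SquareSeq.right_mem_coords hm) ?_ hnext₁).mono le_rfl ?_))
    · refine hs₁.congr (fun a _ _ => rfl) fun a ha _ _ _ => ?_
      rw [real_setReal, if_neg ha]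
    · simp [real_setReal, NatExpr.eval, RealExpr.eval, h6, hs₁.loaded.x, hs₁.loaded.w,
        SquareSeq.right]
    · simp [real_setReal, hd₁]
    rintro s₂ ⟨h7, h8, d₂, hd₂, hnext₂⟩
    refine ⟨by rw [h7 3 (by decide), nat_setReal, h6], by simp [nat_setNat], ?_, ?_, _, ?_,
      d₂, hd₂, hnext₂⟩
    · intro a ha ha'
      rw [nat_setNat, if_neg ha', h7 a ha, nat_setReal, h4' a ha ha', h2 a ha ha']
    · intro a ha ha' ha'' ha'''
      rw [real_setNat, h8 a ha' ha'' ha''', real_setReal, if_neg ha, h5' a ha ha' ha'' ha''',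
        h3 a ha ha' ha'' ha''']
    · intro j hj
      rcases Nat.lt_succ_iff_lt_or_eq.1 hj with h9 | rfl
      · exact ⟨by simp [(hA j h9).1], by simp [(hA j h9).2]⟩
      · simp
  · refine ⟨by simp [nat_setNat], fun a _ ha => ?_, fun a _ _ _ ha => ?_, ∅, by simp,
      Q.right i, ?_, SquareSeq.isNext_right hi hc⟩
    · rw [nat_setNat, if_neg ha, nat_setReal]
    · rw [real_setNat, real_setReal, if_neg ha]
    · simp [real_setNat, real_setReal, NatExpr.eval, RealExpr.eval, hs.index, hs.loaded.x,
        hs.loaded.w, SquareSeq.right]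
  · have : (200 * Q.len + 250 + 20) * Q.len ≤ (200 * Q.len + 300) * Q.len :=
      Nat.mul_le_mul_right _ (by omega)
    omega
  · rintro s' ⟨-, h1, h2, A, hA, d, hd, hnext⟩
    refine ⟨h1, h2, d, hd, hnext.mono fun e he => ?_⟩
    obtain ⟨j, hj, rfl | rfl⟩ := SquareSeq.mem_coords.1 he
    · exact (hA j hj).1
    · exact (hA j hj).2

theorem runs_storeProg (hs : Stored s R) (r : AARect) (h1 : s.real 11 0 = r.x₁)
    (h2 : s.real 14 0 = r.x₂) (h3 : s.real 12 0 = r.y₁) (h4 : s.real 13 0 = r.y₂) :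
    Runs storeProg 40 s fun s' =>
      (∀ a ≠ 1, s'.nat a = s.nat a) ∧ (∀ a, a < 4 ∨ 8 ≤ a → s'.real a = s.real a) ∧
      Stored s' (R ++ [r]) := by
  refine Runs.mono (T := 6 + (6 + (6 + (6 + 6)))) (Runs.seq (Runs.setReal (by decide)
    (Runs.seq (Runs.setReal (by decide) (Runs.seq (Runs.setReal (by decide)
    (Runs.seq (Runs.setReal (by decide) (Runs.setNat (by decide) ?_)))))))))
    (by decide) fun _ h => h
  refine ⟨fun a ha => ?_, fun a ha => ?_, ?_, fun j hj => ?_⟩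
  · simp [nat_setNat, nat_setReal, ha]
  · simp only [real_setNat, real_setReal]
    rw [if_neg (by omega), if_neg (by omega), if_neg (by omega), if_neg (by omega)]
  · simp [nat_setNat, nat_setReal, NatExpr.eval, hs.length]
  · simp only [real_setNat, real_setReal, nat_setReal, NatExpr.eval, RealExpr.eval, hs.length]
    rw [List.length_append, List.length_singleton] at hj
    rcases Nat.lt_succ_iff_lt_or_eq.1 hj with hj | rfl
    · simpa [List.getElem_append_left hj, Function.update_of_ne hj.ne] using hs.get j hj
    · simp [h1, h2, h3, h4]

/-- The invariant of the sweep over the `i`-th square. -/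
structure Sweeping (Q : SquareSeq) (i : ℕ) (s : State) : Prop where
  loaded : Loaded Q s
  index : s.nat 4 0 = i
  x_le : Q.x i ≤ s.real 11 0
  le_right : s.real 11 0 ≤ Q.right i
  mem : s.real 11 0 ∈ Q.coords
  isBreak : s.real 11 0 < Q.right i → Q.IsBreak i (s.real 11 0)
  stored : ∃ R, Q.IsPartial i (s.real 11 0) R ∧ Stored s R

theorem runs_pieceProg (hi : i < Q.len) (hs : Sweeping Q i s) (hlt : s.real 11 0 < Q.right i) :
    Runs pieceProg ((200 * Q.len + 400) * Q.len + 250) s fun s' =>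
      Sweeping Q i s' ∧ s.real 11 0 < s'.real 11 0 := by
  set c := s.real 11 0 with hc
  obtain ⟨R, hR, hsR⟩ := hs.stored
  refine Runs.mono (T := 10 + ((100 * Q.len + 50) + (10 + (10 +
    (((200 * Q.len + 300) * Q.len + 50) + (60 + 10))))))
    (Runs.seq (Runs.setReal (by decide) (Runs.seq ((runs_boundsProg (Q := Q) ?_).mono le_rfl ?_))))
    ?_ fun _ h => h
  · refine hs.loaded.congr rfl fun a ha => ?_
    rw [real_setReal, if_neg (by omega)]
  · rintro s₁ ⟨h1, h2, h3, h4⟩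
    have h1' : ∀ a ≠ 2, s₁.nat a = s.nat a := h1
    have h2' : ∀ a, a ≠ 8 → a ≠ 9 → a ≠ 10 → s₁.real a = s.real a := fun a h8 h9 h10 => by
      rw [h2 a h9 h10, real_setReal, if_neg h8]
    have h11 : s₁.real 11 0 = c := by rw [h2' 11 (by decide) (by decide) (by decide)]
    have h8 : (s.setReal 8 0 (s.real 11 0)).real 8 0 = c := by simp [real_setReal, hc]
    simp only [NatExpr.eval, RealExpr.eval, h8, nat_setReal, hs.index] at h3 h4
    refine Runs.seq (Runs.setReal (by decide) (Runs.seq (Runs.setReal (by decide)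
      (Runs.seq ((runs_nextProg (Q := Q) (i := i) (c := c) ?_ hi hlt).mono le_rfl ?_)))))
    · refine ⟨hs.loaded.congr (h1' 0 (by decide)) fun a ha => ?_, ?_, ?_, ?_, ?_⟩
      · simp only [real_setReal]
        rw [if_neg (by omega), if_neg (by omega), h2' a (by omega) (by omega) (by omega)]
      · rw [nat_setReal, nat_setReal, h1' 4 (by decide), hs.index]
      · simp [real_setReal, h11]
      · simp [real_setReal, NatExpr.eval, RealExpr.eval, h3]
      · simp [real_setReal, NatExpr.eval, RealExpr.eval, h4]
    rintro s₂ ⟨h5, h6, d, hd, hnext⟩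
    have h5' : ∀ a, a ≠ 2 → a ≠ 3 → s₂.nat a = s.nat a := fun a ha ha' => by
      rw [h5 a ha ha', nat_setReal, nat_setReal, h1' a ha]
    have h6' : ∀ a, a < 8 ∨ a = 11 → s₂.real a = s.real a := fun a ha => by
      rw [h6 a (by omega) (by omega) (by omega) (by omega), real_setReal, if_neg (by omega),
        real_setReal, if_neg (by omega), h2' a (by omega) (by omega) (by omega)]
    have h12 : s₂.real 12 0 = Q.low i c := by
      rw [h6 12 (by decide) (by decide) (by decide) (by decide)]
      simp [real_setReal, NatExpr.eval, RealExpr.eval, h3]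
    have h13 : s₂.real 13 0 = Q.high i c := by
      rw [h6 13 (by decide) (by decide) (by decide) (by decide)]
      simp [real_setReal, NatExpr.eval, RealExpr.eval, h4]
    have hs₂ : Stored s₂ R := hsR.congr (h5' 1 (by decide) (by decide))
      fun a _ ha => h6' a (Or.inl ha)
    -- What remains to be shown once the piece, if it is not empty, has been stored.
    have key (s₃ : State) (hn : ∀ a ≠ 1, s₃.nat a = s₂.nat a)
        (hr : ∀ a, a < 4 ∨ 8 ≤ a → s₃.real a = s₂.real a) {R' : List AARect}
        (hs₃ : Stored s₃ R') (hR' : Q.IsPartial i d R') :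
        Runs (.setReal 11 (.const 0) (realVar 14)) 10 s₃
          fun s' => Sweeping Q i s' ∧ c < s'.real 11 0 := by
      have h7 : s₃.real 14 0 = d := by rw [hr 14 (Or.inr (by decide)), hd]
      refine Runs.setReal (by decide) ?_
      have h8 : (s₃.setReal 11 0 (s₃.real 14 0)).real 11 0 = d := by simp [real_setReal, h7]
      simp only [NatExpr.eval, RealExpr.eval]
      refine ⟨⟨hs.loaded.congr ?_ fun a ha => ?_, ?_, ?_, ?_, ?_, ?_, R', ?_, ?_⟩, ?_⟩
      · rw [nat_setReal, hn 0 (by decide), h5' 0 (by decide) (by decide)]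
      · rw [real_setReal, if_neg (by omega), hr a (by omega), h6' a (by omega)]
      · rw [nat_setReal, hn 4 (by decide), h5' 4 (by decide) (by decide), hs.index]
      · rw [h8]; exact hs.x_le.trans hnext.lt.le
      · rw [h8]; exact hnext.le
      · rw [h8]; exact hnext.mem
      · rw [h8]; exact hnext.isBreak hs.x_le hs.mem
      · rw [h8]; exact hR'
      · refine hs₃.congr rfl fun a _ ha => ?_
        rw [real_setReal, if_neg (by omega)]
      · rw [h8]; exact hnext.lt
    refine Runs.seq (Runs.ite 50 (by decide) (fun hb => ?_) (fun hb => ?_))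
    all_goals
      simp only [Cond.Holds, RealExpr.eval, NatExpr.eval, h12, h13] at hb
    · exact Runs.skip (by decide) (key s₂ (fun _ _ => rfl) (fun _ _ => rfl) hs₂
        (hR.skip hnext (not_lt.2 hb)))
    · rw [not_le] at hb
      have h11' : s₂.real 11 0 = c := by rw [h6' 11 (Or.inr rfl)]
      refine (runs_storeProg hs₂ ⟨c, d, Q.low i c, Q.high i c, hnext.lt, hb⟩ h11' hd h12
        h13).mono (by decide) ?_
      rintro s₃ ⟨h7, h8, h9⟩
      exact key s₃ h7 h8 h9 (hR.append hi hs.x_le (hs.isBreak hlt) hnext hb)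
  · ring_nf
    omega

theorem runs_sweepProg (hi : i < Q.len) (hs : Loaded Q s) (hsi : s.nat 4 0 = i)
    (hR : Q.IsPartial i (Q.x i) R) (hsR : Stored s R) :
    Runs sweepProg (((200 * Q.len + 400) * Q.len + 300) * (2 * Q.len) + 50) s fun s' =>
      Sweeping Q i s' ∧ s'.real 11 0 = Q.right i := by
  set s₀ := s.setReal 11 0 (Q.x i) with hs₀
  have h11 : s₀.real 11 0 = Q.x i := by simp [hs₀, real_setReal]
  have hinit : Sweeping Q i s₀ := by
    refine ⟨hs.congr rfl fun a ha => ?_, hsi, h11.ge, ?_, ?_, fun _ => Or.inl h11, R, ?_, ?_⟩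
    · rw [hs₀, real_setReal, if_neg (by omega)]
    · rw [h11]; exact (SquareSeq.x_lt_right hi).le
    · rw [h11]; exact SquareSeq.x_mem_coords hi
    · rw [h11]; exact hR
    · refine hsR.congr rfl fun a _ ha => ?_
      rw [hs₀, real_setReal, if_neg (by omega)]
  -- Each piece takes the sweep to a later one of the abscissas of vertical sides.
  have hloop := Runs.loop (s := s₀) (p := pieceProg) (P := Sweeping Q i)
    (b := .not (.realLe (.add (.get 0 (natVar 4)) (.get 2 (natVar 4))) (realVar 11)))
    (T := (200 * Q.len + 400) * Q.len + 250)
    (fun s => (Q.coords.filter (s.real 11 0 < ·)).card) ?_ hinit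
  · have hstep : s.setReal 11 ((NatExpr.const 0).eval s)
        (RealExpr.eval s (.get 0 (natVar 4))) = s₀ := by
      simp only [NatExpr.eval, RealExpr.eval, hsi, hs.x, hs₀]
    rw [← hstep] at hloop
    refine (Runs.seq (T := 10) (Runs.setReal (by decide) hloop)).mono ?_ ?_
    · rw [hstep]
      have h1 : (Q.coords.filter (s₀.real 11 0 < ·)).card ≤ 2 * Q.len :=
        (Finset.card_filter_le _ _).trans SquareSeq.card_coords_le
      have h2 := Nat.mul_le_mul (show (Cond.not (.realLe (.add (.get 0 (natVar 4))
        (.get 2 (natVar 4))) (realVar 11))).cost + 1 + ((200 * Q.len + 400) * Q.len + 250) ≤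
          (200 * Q.len + 400) * Q.len + 300 by
            simp only [Cond.cost, RealExpr.cost, NatExpr.cost]; omega) h1
      simp only [Cond.cost, RealExpr.cost, NatExpr.cost] at h2 ⊢
      omega
    · rintro s' ⟨h1, h2⟩
      refine ⟨h1, h1.le_right.antisymm ?_⟩
      simpa [Cond.Holds, RealExpr.eval, NatExpr.eval, h1.index, h1.loaded.x, h1.loaded.w,
        SquareSeq.right] using h2
  · intro s hs hb
    have hlt : s.real 11 0 < Q.right i := by
      simpa [Cond.Holds, RealExpr.eval, NatExpr.eval, hs.index, hs.loaded.x, hs.loaded.w,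
        SquareSeq.right] using hb
    refine (runs_pieceProg hi hs hlt).mono le_rfl fun s' ⟨h1, h2⟩ => ⟨h1, ?_⟩
    refine Finset.card_lt_card (Finset.ssubset_iff_of_subset ?_ |>.2 ⟨s'.real 11 0, ?_, ?_⟩)
    · exact Finset.monotone_filter_right _ fun e _ he => h2.trans he
    · exact Finset.mem_filter.2 ⟨h1.mem, h2⟩
    · simp

theorem runs_copyProg (hs : Stored s R) :
    Runs copyProg (100 * R.length + 50) s fun s' => HasOutput s' R := by
  refine Runs.mono (T := (60 + 20) * R.length + 20 + 10) (Runs.seq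
    ((Runs.forLoop (T := 60) (N := R.length) (fun m s' =>
      s'.nat 3 0 = m ∧ Stored s' R ∧ ∀ j < m, s'.real 0 j = s'.real 4 j ∧
        s'.real 1 j = s'.real 5 j ∧ s'.real 2 j = s'.real 6 j ∧ s'.real 3 j = s'.real 7 j)
      ?_ ?_ ?_).mono le_rfl ?_)) (by omega) fun _ h => h
  · rintro m s' ⟨h1, h2, -⟩
    exact ⟨h1, h2.length⟩
  · rintro m - s' ⟨h1, h2, h3⟩
    refine Runs.mono (T := 10 + (10 + (10 + 10))) (Runs.seq (Runs.setReal (by decide)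
      (Runs.seq (Runs.setReal (by decide) (Runs.seq (Runs.setReal (by decide)
      (Runs.setReal (by decide) ?_))))))) (by decide) fun _ h => h
    refine ⟨h1, by simp [nat_setNat], h2.congr ?_ fun a ha ha' => ?_, fun j hj => ?_⟩
    · simp [nat_setNat, nat_setReal]
    · simp only [real_setNat, real_setReal]
      rw [if_neg (by omega), if_neg (by omega), if_neg (by omega), if_neg (by omega)]
    · simp only [real_setNat, real_setReal, nat_setReal, NatExpr.eval, RealExpr.eval, h1]
      rcases Nat.lt_succ_iff_lt_or_eq.1 hj with hj | rfl
      · simpa [Function.update_of_ne hj.ne] using h3 j hj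
      · simp
  · exact ⟨by simp [nat_setNat], hs.congr (by simp [nat_setNat]) fun _ _ _ => rfl, by simp⟩
  · rintro s' ⟨-, h1, h2⟩
    refine Runs.setNat (by decide) ⟨?_, fun j hj => ?_⟩
    · simp [nat_setNat, NatExpr.eval, h1.length]
    · obtain ⟨h3, h4, h5, h6⟩ := h2 j hj
      rw [real_setNat, h3, h4, h5, h6]
      exact h1.get j hj

theorem runs_mainProg (hs : Loaded Q s) :
    Runs mainProg ((((200 * Q.len + 400) * Q.len + 300) * (2 * Q.len) + 700) * Q.len + 100) s
      fun s' => ∃ R, HasOutput s' R ∧ Q.IsPartial Q.len (Q.x Q.len) R := by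
  refine Runs.mono (T := 3 + ((((((200 * Q.len + 400) * Q.len + 300) * (2 * Q.len) + 50) + 20) *
    Q.len + 20) + (600 * Q.len + 50))) (Runs.seq (Runs.setNat (by decide) (Runs.seq
    ((Runs.forLoop (T := ((200 * Q.len + 400) * Q.len + 300) * (2 * Q.len) + 50) (N := Q.len)
      (fun m s' => s'.nat 4 0 = m ∧ Loaded Q s' ∧ ∃ R, Stored s' R ∧ Q.IsPartial m (Q.x m) R)
      ?_ ?_ ?_).mono le_rfl ?_)))) ?_ fun _ h => h
  · rintro m s' ⟨h1, h2, -⟩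
    exact ⟨h1, h2.len⟩
  · rintro m hm s' ⟨h1, h2, R, h3, h4⟩
    refine (runs_sweepProg hm h2 h1 h4 h3).mono le_rfl fun s'' ⟨h5, h6⟩ => ?_
    obtain ⟨R', h7, h8⟩ := h5.stored
    refine ⟨h5.index, by simp [nat_setNat], h5.loaded.congr (by simp [nat_setNat])
      fun _ _ => rfl, R', h8.congr (by simp [nat_setNat]) fun _ _ _ => rfl, ?_⟩
    rw [h6] at h7
    exact h7.succ
  · refine ⟨by simp [nat_setNat], hs.congr (by simp [nat_setNat]) fun _ _ => rfl, [], ?_,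
      SquareSeq.isPartial_nil⟩
    exact ⟨by simp [nat_setNat, NatExpr.eval], by simp⟩
  · rintro s' ⟨-, h2, R, h3, h4⟩
    have := h4.length_le
    exact (runs_copyProg h3).mono (by omega) fun s'' h5 => ⟨R, h5, h4⟩
  · ring_nf
    omega

end RealRAM

/-- A finite family of squares as a sequence, continued by zeros. -/
noncomputable def SquareSeq.ofFin {n : ℕ} (S : Fin n → AASquare) : SquareSeq where
  len := n
  x := (RealRAM.input S).real 0
  y := (RealRAM.input S).real 1
  w := (RealRAM.input S).real 2
  w_pos i hi := by simpa [RealRAM.input, hi] using (S ⟨i, hi⟩).side_pos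

theorem SquareSeq.ofFin_toSet {n : ℕ} (S : Fin n → AASquare) (i : Fin n) :
    Set.Icc ((ofFin S).x i) ((ofFin S).right i) ×ˢ Set.Icc ((ofFin S).y i) ((ofFin S).top i) =
      (S i).toSet := by
  simp [ofFin, right, top, RealRAM.input, AASquare.toSet]

theorem mainTheorem10 :
    ∃ (prog : RealRAM.Prog) (p : Polynomial ℕ),
      ∀ (n : ℕ) (S : Fin n → AASquare),
        ∃ (t : ℕ) (s : RealRAM.State) (R : List AARect),
          RealRAM.Run prog (RealRAM.input S) t s ∧
          t ≤ p.eval n ∧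
          RealRAM.HasOutput s R ∧
          R.length ≤ 9 * n ∧
          R.Pairwise (fun r r' => Disjoint (interior r.toSet) (interior r'.toSet)) ∧
          (⋃ r ∈ R, r.toSet) = (⋃ i, (S i).toSet) ∧
          ∀ r ∈ R, ∃ i, r.toSet ⊆ (S i).toSet := by
  open Polynomial in
  refine ⟨RealRAM.mainProg,
    (((200 * X + 400) * X + 300) * (2 * X) + 700) * X + 100, fun n S => ?_⟩
  have hload : RealRAM.Loaded (SquareSeq.ofFin S) (RealRAM.input S) :=
    ⟨by simp [RealRAM.input, SquareSeq.ofFin], rfl, rfl, rfl⟩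
  obtain ⟨t, s, hrun, ht, R, hout, hR⟩ := RealRAM.runs_mainProg hload
  have hlen : (SquareSeq.ofFin S).len = n := rfl
  refine ⟨t, s, R, hrun, ?_, hout, ?_, hR.disjoint, ?_, fun r hr => ?_⟩
  · simpa [hlen] using ht
  · have := hR.length_le
    omega
  · rw [hR.iUnion_eq]
    ext z
    simp only [Set.mem_iUnion, Finset.mem_range, ← SquareSeq.ofFin_toSet]
    exact ⟨fun ⟨j, hj, hz⟩ => ⟨⟨j, hj⟩, hz⟩, fun ⟨i, hz⟩ => ⟨i, i.2, hz⟩⟩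
  · obtain ⟨j, hj, hsub⟩ := hR.subset hr
    exact ⟨⟨j, hj⟩, SquareSeq.ofFin_toSet S ⟨j, hj⟩ ▸ hsub⟩
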